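/- **Theorem (Sylvester's identity for $\mathbf q$-Cartier-Foata matrices).** Let $0\le n<m$ be integers and let $q_{ij}$ $(1\le i<j\le m)$ be non-zero complex numbers. Let $\mathcal A$ be the $\mathbb C$-algebra of formal power series in the non-commuting variables $a_{ij}$, $1\le i,j\le m$, let $\mathcal J$ be a two-sided ideal of $\mathcal A$, and suppose that modulo $\mathcal J$ the matrix $A=(a_{ij})_{m\times m}$ is $\mathbf q$-Cartier-Foata, that is, in $\mathcal A/\mathcal J$ $$q_{kl}\,a_{jl}a_{ik}=q_{ij}\,a_{ik}a_{jl}\quad(i<j,\ k<l),$$ $$a_{jl}a_{ik}=q_{ij}q_{lk}\,a_{ik}a_{jl}\quad(i<j,\ k>l),$$ $$a_{jk}a_{ik}=q_{ij}\,a_{ik}a_{jk}\quad(i<j).$$ (The smallest such $\mathcal J$ is the ideal generated by these relations.) For a square matrix $B=(b_{ij})_{k\times k}$ whose entries are polynomials in the non-commuting variables $a_{ij}$, let $\det_{\mathbf q}B$ be obtained by expanding $\sum_{\sigma\in S_k}(-1)^{\operatorname{inv}\sigma}\,b_{\sigma(1)1}\cdots b_{\sigma(k)k}$ into words and multiplying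 each word $a_{\lambda_1\mu_1}\cdots a_{\lambda_\ell\mu_\ell}$ by the weight $$\prod_{r<s,\ \mu_r>\mu_s}q_{\mu_s\mu_r}\ \prod_{r<s,\ \lambda_r>\lambda_s}q_{\lambda_s\lambda_r}^{-1};$$ the result is then read in $\mathcal A/\mathcal J$. Let $A_0=(a_{ij})_{1\le i,j\le n}$, $a_{i*}=(a_{i1},\dots,a_{in})$, $a_{*j}=(a_{1j},\dots,a_{nj})^{T}$. Suppose that $q_{ij}=q_{i'j'}$ for all $i,i'\le n$ and $j,j'>n$. Then $\det_{\mathbf q}(I-A_0)$ is invertible in $\mathcal A/\mathcal J$ and, with $$c^{\mathbf q}_{ij}=-\,{\det}_{\mathbf q}^{-1}(I-A_0)\cdot{\det}_{\mathbf q}\begin{pmatrix}I-A_0&-a_{*j}\\-a_{i*}&-a_{ij}\end{pmatrix},\qquad C^{\mathbf q}=(c^{\mathbf q}_{ij})_{n+1\le i,j\le m},$$ we have $${\det}_{\mathbf q}^{-1}(I-A_0)\cdot{\det}_{\mathbf q}(I-A)={\det}_{\mathbf q}(I-C^{\mathbf q}).$$ Here $\det_{\mathbf q}(I-C^{\mathbf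 q})$ is taken with respect to the entries of $C^{\mathbf q}$: one forms $\det_{\mathbf q}(I-X)$ for a matrix $X=(x_{ij})_{n+1\le i,j\le m}$ of non-commuting variables, words in the $x_{ij}$ being weighted as above, and then substitutes $x_{ij}=c^{\mathbf q}_{ij}$. The condition $q_{ij}=q_{i'j'}$ cannot be dropped: for $n=1$, $m=3$ and any non-zero $q_{12},q_{13},q_{23}$ with $q_{12}\ne q_{13}$, there is a two-sided ideal $\mathcal J$ such that $A$ is $\mathbf q$-Cartier-Foata modulo $\mathcal J$ and $\det_{\mathbf q}(I-A_0)$ is invertible in $\mathcal A/\mathcal J$, but the displayed identity fails in $\mathcal A/\mathcal J$. -/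

import Mathlib

noncomputable section

/-! ### Formal power series in non-commuting variables -/

/-- Formal power series over `ℂ` in non-commuting variables indexed by `α`: a series is the family
of its coefficients, one for every word (finite list) in the variables. -/
def NCPowerSeries (α : Type*) : Type _ := List α → ℂ

namespace NCPowerSeries

variable {α : Type*}

instance : AddCommGroup (NCPowerSeries α) := inferInstanceAs (AddCommGroup (List α → ℂ))

instance : Module ℂ (NCPowerSeries α) := inferInstanceAs (Module ℂ (List α → ℂ))

/-- Cauchy product: the coefficient of `f * g` at a word `w` is the sum of `f u * g v` over all
factorizations `w = u ++ v`. -/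
instance : Mul (NCPowerSeries α) :=
  ⟨fun f g w => ∑ p ∈ Finset.range (w.length + 1), f (w.take p) * g (w.drop p)⟩

instance : One (NCPowerSeries α) := ⟨fun w => if w.length = 0 then 1 else 0⟩

theorem mul_apply (f g : NCPowerSeries α) (w : List α) :
    (f * g) w = ∑ p ∈ Finset.range (w.length + 1), f (w.take p) * g (w.drop p) := rfl

theorem one_apply (w : List α) :
    (1 : NCPowerSeries α) w = if w.length = 0 then 1 else 0 := rfl

theorem add_apply (f g : NCPowerSeries α) (w : List α) : (f + g) w = f w + g w := rfl

theorem zero_apply (w : List α) : (0 : NCPowerSeries α) w = 0 := rfl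

theorem smul_apply (c : ℂ) (f : NCPowerSeries α) (w : List α) : (c • f) w = c * f w := rfl

/-- The coefficients of `f` at the words that begin with the letter `x`. -/
def shift (x : α) (f : NCPowerSeries α) : NCPowerSeries α := fun w => f (x :: w)

theorem mul_nil (f g : NCPowerSeries α) : (f * g) [] = f [] * g [] := by
  simp [mul_apply]

theorem mul_cons (f g : NCPowerSeries α) (x : α) (w : List α) :
    (f * g) (x :: w) = f [] * g (x :: w) + (shift x f * g) w := by
  rw [mul_apply, mul_apply, List.length_cons, Finset.sum_range_succ']
  simp [shift, add_comm]

protected theorem add_mul (f g h : NCPowerSeries α) : (f + g) * h = f * h + g * h := by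
  funext w
  simp only [mul_apply, add_apply, add_mul, Finset.sum_add_distrib]

protected theorem mul_add (f g h : NCPowerSeries α) : f * (g + h) = f * g + f * h := by
  funext w
  simp only [mul_apply, add_apply, mul_add, Finset.sum_add_distrib]

protected theorem smul_mul (c : ℂ) (f g : NCPowerSeries α) : (c • f) * g = c • (f * g) := by
  funext w
  simp only [mul_apply, smul_apply, Finset.mul_sum, mul_assoc]

protected theorem mul_smul (c : ℂ) (f g : NCPowerSeries α) : f * (c • g) = c • (f * g) := by
  funext w
  simp only [mul_apply, smul_apply, Finset.mul_sum, mul_left_comm]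

theorem shift_mul (x : α) (f g : NCPowerSeries α) :
    shift x (f * g) = f [] • shift x g + shift x f * g := by
  funext w
  exact mul_cons f g x w

protected theorem mul_assoc (f g h : NCPowerSeries α) : f * g * h = f * (g * h) := by
  funext w
  induction w generalizing f with
  | nil => simp only [mul_nil, mul_assoc]
  | cons x w ih =>
    rw [mul_cons, mul_cons, shift_mul, NCPowerSeries.add_mul, add_apply, NCPowerSeries.smul_mul,
      smul_apply, ih, mul_nil, mul_cons]
    ring

protected theorem one_mul (f : NCPowerSeries α) : 1 * f = f := by
  have h0 : ∀ (x : α), shift x (1 : NCPowerSeries α) = 0 := fun x => by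
    funext w
    simp [shift, one_apply, zero_apply]
  funext w
  cases w with
  | nil => simp [mul_nil, one_apply]
  | cons x w =>
    rw [mul_cons, h0]
    simp [mul_apply, one_apply, zero_apply]

protected theorem mul_one (f : NCPowerSeries α) : f * 1 = f := by
  funext w
  induction w generalizing f with
  | nil => simp [mul_nil, one_apply]
  | cons x w ih =>
    rw [mul_cons, ih]
    simp [one_apply, shift]

instance : Ring (NCPowerSeries α) :=
  { (inferInstance : AddCommGroup (NCPowerSeries α)) with
    mul := (· * ·)
    one := 1
    left_distrib := NCPowerSeries.mul_add
    right_distrib := NCPowerSeries.add_mul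
    zero_mul := fun f => by
      funext w
      simp [mul_apply, zero_apply]
    mul_zero := fun f => by
      funext w
      simp [mul_apply, zero_apply]
    mul_assoc := NCPowerSeries.mul_assoc
    one_mul := NCPowerSeries.one_mul
    mul_one := NCPowerSeries.mul_one }

instance : Algebra ℂ (NCPowerSeries α) :=
  Algebra.ofModule NCPowerSeries.smul_mul NCPowerSeries.mul_smul

open Classical in
/-- The variable `x`, as a power series. -/
def X (x : α) : NCPowerSeries α := fun w => if w = [x] then 1 else 0

end NCPowerSeries

/-- The algebra of formal power series in the non-commuting variables `a i j`, modulo a two-sided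
ideal `J`. -/
abbrev QuotSeries {m : ℕ} (J : TwoSidedIdeal (NCPowerSeries (Fin m × Fin m))) : Type :=
  J.ringCon.Quotient

/-- The matrix of the variables `a i j`, read modulo `J`. -/
def varMatrix {m : ℕ} (J : TwoSidedIdeal (NCPowerSeries (Fin m × Fin m))) :
    Matrix (Fin m) (Fin m) (QuotSeries J) :=
  Matrix.of fun i j => J.ringCon.mk' (NCPowerSeries.X (i, j))

/-- The `q`-Cartier-Foata relations for a matrix over a `ℂ`-algebra. Only the parameters `q i j`
with `i < j` occur. -/
structure IsQCartierFoata {m : ℕ} {R : Type*} [Ring R] [Algebra ℂ R] (q : Fin m → Fin m → ℂ)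
    (a : Matrix (Fin m) (Fin m) R) : Prop where
  rel_lt : ∀ i j k l, i < j → k < l → q k l • (a j l * a i k) = q i j • (a i k * a j l)
  rel_gt : ∀ i j k l, i < j → l < k → a j l * a i k = (q i j * q l k) • (a i k * a j l)
  rel_eq : ∀ i j k, i < j → a j k * a i k = q i j • (a i k * a j k)

/-! ### `q`-determinants -/

/-- Polynomials over `ℂ` in the non-commuting variables `x i j`: finite linear combinations of
words. -/
abbrev NCPoly (m : ℕ) : Type := MonoidAlgebra ℂ (FreeMonoid (Fin m × Fin m))

/-- The generic matrix `(x i j)`. -/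
def genericMatrix (m : ℕ) : Matrix (Fin m) (Fin m) (NCPoly m) :=
  Matrix.of fun i j => MonoidAlgebra.of ℂ _ (FreeMonoid.of (i, j))

/-- The substitution `x i j ↦ a i j`. -/
def substEntries {m : ℕ} {R : Type*} [Ring R] [Algebra ℂ R] (a : Matrix (Fin m) (Fin m) R) :
    NCPoly m →ₐ[ℂ] R :=
  MonoidAlgebra.lift ℂ R _ (FreeMonoid.lift fun p : Fin m × Fin m => a p.1 p.2)

/-- The product of `q (ν s) (ν r)` over all inversions of the word `ν`, that is, over all pairs of
positions `r < s` with `ν r > ν s`. -/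
def inversionWeight {m : ℕ} (q : Fin m → Fin m → ℂ) (ν : List (Fin m)) : ℂ :=
  ∏ p : Fin ν.length × Fin ν.length with p.1 < p.2 ∧ ν.get p.2 < ν.get p.1,
    q (ν.get p.2) (ν.get p.1)

/-- The weight of the word `x (λ₁, μ₁) ⋯ x (λₗ, μₗ)`: the inversion weight of `μ` divided by the
inversion weight of `λ`. -/
def wordWeight {m : ℕ} (q : Fin m → Fin m → ℂ) (w : List (Fin m × Fin m)) : ℂ :=
  inversionWeight q (w.map Prod.snd) * (inversionWeight q (w.map Prod.fst))⁻¹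

/-- Multiply every word of a polynomial by its weight. -/
def applyWeight {m : ℕ} (q : Fin m → Fin m → ℂ) (f : NCPoly m) : NCPoly m :=
  f.coeff.sum fun w c => MonoidAlgebra.single w (wordWeight q (FreeMonoid.toList w) * c)

/-- The `q`-determinant of a square matrix `B` of non-commutative polynomials: expand
`∑ σ, sign σ * B (σ 1) 1 * ⋯ * B (σ k) k` (factors in this order) and multiply every word by its
weight. -/
def qDet {m k : ℕ} (q : Fin m → Fin m → ℂ) (B : Matrix (Fin k) (Fin k) (NCPoly m)) : NCPoly m :=
  applyWeight q (∑ σ : Equiv.Perm (Fin k),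
    ((Equiv.Perm.sign σ : ℤ) : NCPoly m) * (List.ofFn fun p => B (σ p) p).prod)

/-- `det_q (I - A)` for a matrix `A` over an algebra `R`; the words that carry weights are the words
in the entries of `A`. -/
def qDetOneSub {m : ℕ} {R : Type*} [Ring R] [Algebra ℂ R] (q : Fin m → Fin m → ℂ)
    (A : Matrix (Fin m) (Fin m) R) : R :=
  substEntries A (qDet q (1 - genericMatrix m))

section Blocks

variable {n r : ℕ} {R : Type*} [Ring R] [Algebra ℂ R]

/-- `det_q (I - A₀)`, where `A₀` is the upper left `n × n` block of `A`. -/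
def qDetOneSubBlock (q : Fin (n + r) → Fin (n + r) → ℂ)
    (A : Matrix (Fin (n + r)) (Fin (n + r)) R) : R :=
  substEntries A
    (qDet q (1 - (genericMatrix (n + r)).submatrix (Fin.castAdd r) (Fin.castAdd r)))

/-- The bordered matrix with blocks `I - A₀`, `- a_{*j}`, `- a_{i*}`, `- a_{ij}` for the generic
matrix `A`; the indices `i, j : Fin r` stand for the rows and columns `n + i`, `n + j` of `A`. -/
def borderedMatrix (n : ℕ) {r : ℕ} (i j : Fin r) :
    Matrix (Fin (n + 1)) (Fin (n + 1)) (NCPoly (n + r)) :=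
  (Matrix.fromBlocks
    (1 - (genericMatrix (n + r)).submatrix (Fin.castAdd r) (Fin.castAdd r))
    (-(genericMatrix (n + r)).submatrix (Fin.castAdd r) (fun _ : Fin 1 => Fin.natAdd n j))
    (-(genericMatrix (n + r)).submatrix (fun _ : Fin 1 => Fin.natAdd n i) (Fin.castAdd r))
    (-(genericMatrix (n + r)).submatrix (fun _ : Fin 1 => Fin.natAdd n i)
      (fun _ : Fin 1 => Fin.natAdd n j))).reindex finSumFinEquiv finSumFinEquiv

/-- The matrix `C` with entries `c i j = - (det_q (I - A₀))⁻¹ * det_q (bordered matrix)`. -/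
def schurMatrix (q : Fin (n + r) → Fin (n + r) → ℂ)
    (A : Matrix (Fin (n + r)) (Fin (n + r)) R) : Matrix (Fin r) (Fin r) R :=
  Matrix.of fun i j =>
    -(Ring.inverse (qDetOneSubBlock q A) * substEntries A (qDet q (borderedMatrix n i j)))

/-- Sylvester's identity `(det_q (I - A₀))⁻¹ * det_q (I - A) = det_q (I - C)`; the last determinant
is taken with respect to the entries of `C`, with the parameters whose indices exceed `n`. -/
def SylvesterIdentity (q : Fin (n + r) → Fin (n + r) → ℂ)
    (A : Matrix (Fin (n + r)) (Fin (n + r)) R) : Prop :=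
  Ring.inverse (qDetOneSubBlock q A) * qDetOneSub q A =
    qDetOneSub (fun i j : Fin r => q (Fin.natAdd n i) (Fin.natAdd n j)) (schurMatrix q A)

end Blocks

end

noncomputable section

/-! ### Column-ordered determinants over a non-commutative ring -/

section ColDet

variable {E : Type*} [Ring E]

/-! Suppose first that entries of a matrix in different rows commute. Then adding right multiples of
earlier columns to a column does not change the column-ordered determinant (`colDet_sub_mul`): the
error terms are determinants with two proportional columns, whose summands cancel in pairs. Clearing
the upper right block in this way gives the Schur formula `colDet_schur`. Applied to 1 - A it yields
det(1 - A) = P det(1 - C) with P = det(1 - A₀); applied to a bordered matrix it yields -P C_ij.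

The q-Cartier-Foata case reduces to this one by a twist. Take a quantum torus with y_j y_l = q_lj
y_l y_j for l < j, and replace a_ij by the operator a_ij ⊗ (y_j · y_i⁻¹). The relations make
different rows commute (`twistedMatrix_commute`). A word with columns μ and rows λ then acts through
y_{μ₁}⋯y_{μₗ} on the left and (y_{λ₁}⋯y_{λₗ})⁻¹ on the right. Sorting these two products produces
the weight of the word, times a scalar that depends only on the contents of μ and λ and on the
degree b acted upon (`substEntries_of_place`).

Each determinant is homogeneous for a suitable grading, and the scalar must be constant on its words
to be pulled out (`substEntries_place_of_mem`). For degrees b supported beyond n with coordinate sum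
0 this is where the condition on q enters: the parameters linking the two blocks occur with total
exponent a multiple of that sum (`torusCocycle_append_right_left`). Hence P acts as the block
q-determinant, and C acts as the matrix of the c_ij twisted by the smaller torus. Evaluating det(1 -
A) = P det(1 - C) in degree 0 gives the identity. Over power series modulo an ideal the required
linear systems are solvable because the entries of A₀ have no constant term.

For the failure, let A have only the entries x = a₂₁, y = a₃₂, z = a₁₃, with zero squares and the
commutations forced by the relations. The identity then compares (q₁₂q₁₃)⁻¹ xyz with (q₂₃q₁₂)⁻¹ yxz
= q₁₂⁻² xyz, and xyz ≠ 0 in the quotient. -/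

/-- The determinant of a matrix over a ring, with the factors of every product ordered by their
columns. -/
def colDet {m : ℕ} (B : Matrix (Fin m) (Fin m) E) : E :=
  ∑ σ : Equiv.Perm (Fin m), ((Equiv.Perm.sign σ : ℤ) : E) * (List.ofFn fun p => B (σ p) p).prod

theorem map_colDet {E' F : Type*} [Ring E'] [FunLike F E E'] [RingHomClass F E E'] (f : F) {m : ℕ}
    (B : Matrix (Fin m) (Fin m) E) : f (colDet B) = colDet (B.map f) := by
  simp only [colDet, map_sum, map_mul, map_intCast, map_list_prod, List.map_ofFn]
  rfl

theorem List.exists_finRange_eq_append {m : ℕ} (t : Fin m) : ∃ l₁ l₂ : List (Fin m),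
    List.finRange m = l₁ ++ t :: l₂ ∧ (∀ p ∈ l₁, p < t) ∧ (∀ p ∈ l₂, t < p) ∧ (l₁ ++ [t]).Nodup ∧
      ∀ p < t, p ∈ l₁ := by
  obtain ⟨l₁, l₂, h⟩ := List.mem_iff_append.1 (List.mem_finRange t)
  have hs : (List.finRange m).Pairwise (· < ·) := List.pairwise_lt_finRange m
  rw [h, List.pairwise_append] at hs
  obtain ⟨h1, h2, h3⟩ := hs
  rw [List.pairwise_cons] at h2
  have h4 : ∀ p ∈ l₁, p < t := fun p hp => h3 p hp t (by simp)
  refine ⟨l₁, l₂, h, h4, h2.1, ?_, ?_⟩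
  · have : (l₁ ++ [t]).Pairwise (· < ·) := by
      rw [List.pairwise_append]
      exact ⟨h1, by simp, by simpa using h4⟩
    exact this.imp fun h => h.ne
  · intro p hp
    have : p ∈ List.finRange m := List.mem_finRange p
    rw [h, List.mem_append, List.mem_cons] at this
    rcases this with h' | h' | h'
    · exact h'
    · exact absurd h' hp.ne
    · exact absurd (h2.1 p h') hp.not_gt

theorem colDet_updateCol_add {m : ℕ} (X : Matrix (Fin m) (Fin m) E) (t : Fin m)
    (u v : Fin m → E) :
    colDet (X.updateCol t (u + v)) = colDet (X.updateCol t u) + colDet (X.updateCol t v) := by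
  obtain ⟨l₁, l₂, h, h1, h2, -, -⟩ := List.exists_finRange_eq_append t
  simp only [colDet, ← Finset.sum_add_distrib, ← mul_add]
  refine Finset.sum_congr rfl fun σ _ => ?_
  have key : ∀ w : Fin m → E, (List.ofFn fun p => X.updateCol t w (σ p) p).prod =
      (l₁.map fun p => X (σ p) p).prod * (w (σ t) * (l₂.map fun p => X (σ p) p).prod) := by
    intro w
    rw [List.ofFn_eq_map, h, List.map_append, List.map_cons, List.prod_append, List.prod_cons,
      Matrix.updateCol_self,
      List.map_congr_left (g := fun p => X (σ p) p) fun p hp => Matrix.updateCol_ne (h1 p hp).ne,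
      List.map_congr_left (g := fun p => X (σ p) p) fun p hp => Matrix.updateCol_ne (h2 p hp).ne']
  rw [key, key, key, Pi.add_apply, add_mul, mul_add]

/-- The column-ordered determinant as an additive function of one column. -/
def colDetHom {m : ℕ} (X : Matrix (Fin m) (Fin m) E) (t : Fin m) : (Fin m → E) →+ E :=
  AddMonoidHom.mk' (fun u => colDet (X.updateCol t u)) (colDet_updateCol_add X t)

/-- A determinant vanishes if one of its columns is a right multiple of an earlier column and the
entries in different rows up to that column commute. -/
theorem colDet_eq_zero {m : ℕ} (X : Matrix (Fin m) (Fin m) E) {k t : Fin m} (hkt : k < t) (μ : E)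
    (hX : ∀ i, X i t = X i k * μ)
    (hcomm : ∀ i j, i ≠ j → ∀ p p', p < t → p' < t → Commute (X i p) (X j p')) :
    colDet X = 0 := by
  obtain ⟨l₁, l₂, h, h1, h2, hnd, hmem⟩ := List.exists_finRange_eq_append t
  -- Once column t is written as column k times μ, the factors up to t all come from columns before
  -- t and from distinct rows, so they commute. Column k is then used twice, and composing σ with
  -- the transposition of k and t permutes these factors while reversing the sign.
  let c : Fin m → Fin m := fun p => if p = t then k else p
  have hct : c t = k := by simp [c]
  have hc : ∀ p, p ≠ t → c p = p := fun p hp => by simp [c, hp]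
  have hclt : ∀ p ∈ l₁ ++ [t], c p < t := by
    intro p hp
    rcases List.mem_append.1 hp with h' | h'
    · rw [hc p (h1 p h').ne]
      exact h1 p h'
    · rw [List.mem_singleton.1 h', hct]
      exact hkt
  have key : ∀ σ : Equiv.Perm (Fin m), (List.ofFn fun p => X (σ p) p).prod =
      ((l₁ ++ [t]).map fun p => X (σ p) (c p)).prod *
        (μ * (l₂.map fun p => X (σ p) p).prod) := by
    intro σ
    rw [List.ofFn_eq_map, h, List.map_append, List.map_cons, List.prod_append, List.prod_cons, hX,
      List.map_append, List.prod_append, List.map_singleton, List.prod_singleton, hct]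
    have : (l₁.map fun p => X (σ p) (c p)) = l₁.map fun p => X (σ p) p :=
      List.map_congr_left fun p hp => by rw [hc p (h1 p hp).ne]
    rw [this]
    simp only [mul_assoc]
  have hcs : ∀ p, c (Equiv.swap k t p) = c p := by
    intro p
    rcases eq_or_ne p k with rfl | hk
    · rw [Equiv.swap_apply_left, hct, hc _ hkt.ne]
    · rcases eq_or_ne p t with rfl | ht
      · rw [Equiv.swap_apply_right, hct, hc _ hkt.ne]
      · rw [Equiv.swap_apply_of_ne_of_ne hk ht]
  have hperm : ((l₁ ++ [t]).map (Equiv.swap k t)).Perm (l₁ ++ [t]) := by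
    refine (List.perm_ext_iff_of_nodup (hnd.map (Equiv.injective _)) hnd).2 fun p => ?_
    have hiff : ∀ x, x ∈ l₁ ++ [t] ↔ x ≤ t := by
      intro x
      rw [List.mem_append, List.mem_singleton, le_iff_lt_or_eq]
      exact or_congr ⟨h1 x, hmem x⟩ Iff.rfl
    simp only [List.mem_map, hiff]
    constructor
    · rintro ⟨x, hx, rfl⟩
      rw [Equiv.swap_apply_def]
      split_ifs
      exacts [le_rfl, hkt.le, hx]
    · intro hp
      refine ⟨Equiv.swap k t p, ?_, Equiv.swap_apply_self _ _ _⟩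
      rw [Equiv.swap_apply_def]
      split_ifs
      exacts [le_rfl, hkt.le, hp]
  refine Finset.sum_involution (fun σ _ => σ * Equiv.swap k t) ?_ ?_ (fun _ _ => Finset.mem_univ _)
    fun σ _ => by rw [mul_assoc, Equiv.swap_mul_self, mul_one]
  · intro σ _
    have hprod : (List.ofFn fun p => X ((σ * Equiv.swap k t) p) p).prod =
        (List.ofFn fun p => X (σ p) p).prod := by
      rw [key, key]
      congr 1
      · have : ((l₁ ++ [t]).map fun p => X ((σ * Equiv.swap k t) p) (c p)) =
            ((l₁ ++ [t]).map (Equiv.swap k t)).map fun p => X (σ p) (c p) := by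
          rw [List.map_map]
          exact List.map_congr_left fun p _ => by simp [hcs]
        rw [this]
        refine (List.Perm.prod_eq' (hperm.symm.map _) ?_).symm
        rw [List.pairwise_map]
        exact List.Pairwise.imp_of_mem
          (fun hp hp' hne => hcomm _ _ (σ.injective.ne hne) _ _ (hclt _ hp) (hclt _ hp')) hnd
      · refine congrArg (μ * ·) (congrArg List.prod (List.map_congr_left fun p hp => ?_))
        rw [Equiv.Perm.mul_apply,
          Equiv.swap_apply_of_ne_of_ne (hkt.trans (h2 p hp)).ne' (h2 p hp).ne']
    rw [hprod, Equiv.Perm.sign_mul, Equiv.Perm.sign_swap hkt.ne]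
    simp
  · intro σ _ _ heq
    have : Equiv.swap k t = 1 := by simpa using heq
    rw [Equiv.swap_eq_one_iff] at this
    exact hkt.ne this

/-- If entries in different rows of `B` commute, then adding to every column right multiples of
earlier columns does not change the column-ordered determinant. -/
theorem colDet_sub_mul {m : ℕ} (B N : Matrix (Fin m) (Fin m) E)
    (hB : ∀ i j, i ≠ j → ∀ p p', Commute (B i p) (B j p')) (hN : ∀ k p, p ≤ k → N k p = 0) :
    colDet (B - B * N) = colDet B := by
  -- The columns of B are restored from left to right. When column t is treated, the columns before
  -- it already belong to B, where commutation is known; nothing is needed of the later ones.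
  let H : ℕ → Matrix (Fin m) (Fin m) E := fun s =>
    Matrix.of fun i p => if p.val < s then B i p else (B - B * N) i p
  have hstep : ∀ s, s < m → colDet (H s) = colDet (H (s + 1)) := by
    intro s hs
    set t : Fin m := ⟨s, hs⟩ with ht
    have h1 : H s = (H (s + 1)).updateCol t
        ((fun i => H (s + 1) i t) + ∑ k, fun i => B i k * -N k t) := by
      ext i p
      by_cases hp : p = t
      · subst hp
        simp [H, ht, Matrix.mul_apply, sub_eq_add_neg]
      · have : p.val ≠ s := fun h => hp (Fin.ext h)
        rw [Matrix.updateCol_ne hp]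
        simp only [H, Matrix.of_apply]
        congr 1
        exact propext (by omega)
    rw [h1, colDet_updateCol_add, Matrix.updateCol_eq_self]
    have h2 : colDet ((H (s + 1)).updateCol t (∑ k, fun i => B i k * -N k t)) =
        ∑ k, colDet ((H (s + 1)).updateCol t (fun i => B i k * -N k t)) :=
      map_sum (colDetHom (H (s + 1)) t) _ _
    rw [h2, Finset.sum_eq_zero, add_zero]
    intro k _
    by_cases hk : k < t
    · have hlt : ∀ i p, p < t → (H (s + 1)).updateCol t (fun i => B i k * -N k t) i p = B i p := by
        intro i p hp
        rw [Matrix.updateCol_ne hp.ne]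
        have : p.val < s + 1 := by
          have : p.val < s := hp
          omega
        simp [H, this]
      refine colDet_eq_zero _ hk (-N k t) (fun i => ?_) fun i j hij p p' hp hp' => ?_
      · rw [Matrix.updateCol_self, hlt i k hk]
      · rw [hlt i p hp, hlt j p' hp']
        exact hB i j hij p p'
    · rw [hN k t (not_lt.1 hk)]
      simp only [neg_zero, mul_zero]
      exact map_zero (colDetHom (H (s + 1)) t)
  have hall : ∀ s, s ≤ m → colDet (H 0) = colDet (H s) := by
    intro s
    induction s with
    | zero => exact fun _ => rfl
    | succ s ih => exact fun hs => (ih (by omega)).trans (hstep s (by omega))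
  have h0 : H 0 = B - B * N := by
    ext i p
    simp [H]
  have hm : H m = B := by
    ext i p
    simp [H]
  rw [← h0, hall m le_rfl, hm]

/-- A permutation that does not preserve the two blocks sends some right column to an upper row and
contributes zero. For the others, the column order already puts all factors of the first block to
the left. -/
theorem colDet_of_upper_right_zero {n r : ℕ} (X : Matrix (Fin (n + r)) (Fin (n + r)) E)
    (h0 : ∀ i j, X (Fin.castAdd r i) (Fin.natAdd n j) = 0) :
    colDet X = colDet (X.submatrix (Fin.castAdd r) (Fin.castAdd r)) *
      colDet (X.submatrix (Fin.natAdd n) (Fin.natAdd n)) := by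
  classical
  let e : Equiv.Perm (Fin n ⊕ Fin r) ≃ Equiv.Perm (Fin (n + r)) := finSumFinEquiv.permCongr
  have hel : ∀ (τ : Equiv.Perm (Fin n ⊕ Fin r)) i,
      e τ (Fin.castAdd r i) = finSumFinEquiv (τ (Sum.inl i)) := by
    intro τ i
    simp [e, Equiv.permCongr_apply]
  have her : ∀ (τ : Equiv.Perm (Fin n ⊕ Fin r)) j,
      e τ (Fin.natAdd n j) = finSumFinEquiv (τ (Sum.inr j)) := by
    intro τ i
    simp [e, Equiv.permCongr_apply]
  let F : Equiv.Perm (Fin n ⊕ Fin r) → E := fun τ => ((Equiv.Perm.sign τ : ℤ) : E) *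
    ((List.ofFn fun i => X (e τ (Fin.castAdd r i)) (Fin.castAdd r i)).prod *
      (List.ofFn fun j => X (e τ (Fin.natAdd n j)) (Fin.natAdd n j)).prod)
  have hF : colDet X = ∑ τ, F τ := by
    refine (Fintype.sum_equiv e _ _ fun τ => ?_).symm
    simp only [F]
    rw [List.ofFn_add, List.prod_append, Equiv.Perm.sign_permCongr]
    rfl
  rw [hF, ← Finset.sum_subset (Finset.subset_univ
    (((Equiv.Perm.sumCongrHom (Fin n) (Fin r)).range :
      Set (Equiv.Perm (Fin n ⊕ Fin r))).toFinset))]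
  · rw [colDet, colDet, Finset.sum_mul_sum, ← Finset.sum_product', Finset.univ_product_univ]
    symm
    refine Finset.sum_nbij (fun σ => σ.fst.sumCongr σ.snd) ?_ ?_ ?_ ?_
    · exact fun σ _ => Set.mem_toFinset.2 ⟨σ, rfl⟩
    · intro σ₁ _ σ₂ _ h
      have h2 : ∀ x, Equiv.Perm.sumCongr σ₁.fst σ₁.snd x = Equiv.Perm.sumCongr σ₂.fst σ₂.snd x :=
        DFunLike.congr_fun h
      simp only [Sum.map_inr, Sum.map_inl, Equiv.Perm.sumCongr_apply, Sum.forall, Sum.inl.injEq,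
        Sum.inr.injEq] at h2
      ext x
      · exact congrArg _ (h2.left x)
      · exact congrArg _ (h2.right x)
    · intro σ hσ
      rw [Finset.mem_coe, Set.mem_toFinset] at hσ
      obtain ⟨σ₁₂, hσ₁₂⟩ := hσ
      exact ⟨σ₁₂, by simp, by rw [← hσ₁₂]; simp⟩
    · rintro ⟨σ₁, σ₂⟩ -
      simp only [F, hel, her, Equiv.Perm.sumCongr_apply, Sum.map_inl, Sum.map_inr,
        finSumFinEquiv_apply_left, finSumFinEquiv_apply_right, Equiv.Perm.sign_sumCongr,
        Matrix.submatrix_apply]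
      push_cast
      have := Int.cast_commute (Equiv.Perm.sign σ₂ : ℤ)
        (List.ofFn fun i => X (Fin.castAdd r (σ₁ i)) (Fin.castAdd r i)).prod
      rw [mul_assoc, mul_assoc, ← mul_assoc _ (((Equiv.Perm.sign σ₂ : ℤ) : E)), ← this.eq]
      simp only [mul_assoc]
  · intro τ _ hτ
    have h1 : ¬∀ x, ∃ y, Sum.inr y = τ (Sum.inr x) := by
      intro hall
      apply hτ
      rw [Set.mem_toFinset]
      refine Equiv.Perm.mem_sumCongrHom_range_of_perm_mapsTo_inl ?_
      rintro _ ⟨x, rfl⟩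
      by_contra hx
      choose f hf using hall
      have hinj : Function.Injective f := fun a b hab =>
        Sum.inr_injective (τ.injective (by rw [← hf a, ← hf b, hab]))
      obtain ⟨y, hy⟩ : ∃ y, τ (Sum.inl x) = Sum.inr y := by
        rcases hτx : τ (Sum.inl x) with a | b
        · exact absurd ⟨a, hτx.symm⟩ hx
        · exact ⟨b, rfl⟩
      obtain ⟨z, rfl⟩ := (Finite.injective_iff_surjective.1 hinj) y
      exact Sum.inl_ne_inr (τ.injective (hy.trans (hf z)))
    obtain ⟨a, ha⟩ := not_forall.mp h1
    rcases hx : τ (Sum.inr a) with a2 | b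
    · simp only [F]
      rw [List.prod_eq_zero (l := List.ofFn fun j => X (e τ (Fin.natAdd n j)) (Fin.natAdd n j)),
        mul_zero, mul_zero]
      rw [List.mem_ofFn]
      exact ⟨a, by rw [her, hx, finSumFinEquiv_apply_left, h0]⟩
    · exact absurd ⟨b, hx.symm⟩ ha

/-- Sylvester's identity for a matrix whose rows commute with each other. -/
theorem colDet_schur {n r : ℕ} (B : Matrix (Fin (n + r)) (Fin (n + r)) E)
    (hB : ∀ i j, i ≠ j → ∀ p p', Commute (B i p) (B j p')) (M : Matrix (Fin n) (Fin r) E)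
    (hM : ∀ i j, ∑ k, B (Fin.castAdd r i) (Fin.castAdd r k) * M k j =
      B (Fin.castAdd r i) (Fin.natAdd n j)) :
    colDet B = colDet (B.submatrix (Fin.castAdd r) (Fin.castAdd r)) *
      colDet (Matrix.of fun i j => B (Fin.natAdd n i) (Fin.natAdd n j) -
        ∑ k, B (Fin.natAdd n i) (Fin.castAdd r k) * M k j) := by
  -- Strictly upper triangular, so only earlier columns are used; subtracting B N clears the upper
  -- right block by `hM` and leaves the Schur complement at the lower right.
  let N : Matrix (Fin (n + r)) (Fin (n + r)) E :=
    (Matrix.fromBlocks 0 M 0 0).submatrix finSumFinEquiv.symm finSumFinEquiv.symm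
  have hl : ∀ i k, (B - B * N) i (Fin.castAdd r k) = B i (Fin.castAdd r k) := by
    intro i k
    simp [N, Matrix.mul_apply, Fin.sum_univ_add]
  have hr : ∀ i j, (B - B * N) i (Fin.natAdd n j) =
      B i (Fin.natAdd n j) - ∑ k, B i (Fin.castAdd r k) * M k j := by
    intro i j
    simp [N, Matrix.mul_apply, Fin.sum_univ_add]
  rw [← colDet_sub_mul B N hB, colDet_of_upper_right_zero]
  · congr 2
    · ext i j
      exact hl _ _
    · ext i j
      exact hr _ _
  · intro i j
    rw [hr, hM, sub_self]
  · intro k p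
    refine Fin.addCases (fun a => ?_) (fun a => ?_) k <;>
      refine Fin.addCases (fun b => ?_) (fun b => ?_) p <;> intro h
    all_goals try simp [N]
    exfalso
    simp only [Fin.le_def, Fin.val_natAdd, Fin.val_castAdd] at h
    omega

end ColDet

/-! ### The quantum torus -/

section Torus

variable {m : ℕ} (q : Fin m → Fin m → ℂ)

/-- The parameters `q l j` for `l < j`, and `1` otherwise. -/
def upperParam (l j : Fin m) : ℂ := if l < j then q l j else 1

/-- The scalar `χ` in the multiplication rule `y ^ α * y ^ β = χ α β • y ^ (α + β)` of ordered
monomials in a quantum torus whose generators satisfy `y j * y l = q l j • y l * y j` for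
`l < j`. -/
def torusCocycle (α β : Fin m → ℤ) : ℂ := ∏ j, ∏ l, upperParam q l j ^ (α j * β l)

/-- The exponent of the generator `y i`. -/
abbrev unitExp (i : Fin m) : Fin m → ℤ := Pi.single i 1

variable {q}

theorem upperParam_ne_zero (hq : ∀ i j, i < j → q i j ≠ 0) (l j : Fin m) :
    upperParam q l j ≠ 0 := by
  unfold upperParam
  split_ifs with h
  exacts [hq l j h, one_ne_zero]

theorem torusCocycle_ne_zero (hq : ∀ i j, i < j → q i j ≠ 0) (α β : Fin m → ℤ) :
    torusCocycle q α β ≠ 0 :=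
  Finset.prod_ne_zero_iff.2 fun _ _ => Finset.prod_ne_zero_iff.2 fun _ _ =>
    zpow_ne_zero _ (upperParam_ne_zero hq _ _)

theorem torusCocycle_add_left (hq : ∀ i j, i < j → q i j ≠ 0) (α α' β : Fin m → ℤ) :
    torusCocycle q (α + α') β = torusCocycle q α β * torusCocycle q α' β := by
  simp only [torusCocycle, ← Finset.prod_mul_distrib]
  refine Finset.prod_congr rfl fun j _ => Finset.prod_congr rfl fun l _ => ?_
  rw [Pi.add_apply, add_mul, zpow_add₀ (upperParam_ne_zero hq _ _)]

theorem torusCocycle_add_right (hq : ∀ i j, i < j → q i j ≠ 0) (α β β' : Fin m → ℤ) :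
    torusCocycle q α (β + β') = torusCocycle q α β * torusCocycle q α β' := by
  simp only [torusCocycle, ← Finset.prod_mul_distrib]
  refine Finset.prod_congr rfl fun j _ => Finset.prod_congr rfl fun l _ => ?_
  rw [Pi.add_apply, mul_add, zpow_add₀ (upperParam_ne_zero hq _ _)]

@[simp]
theorem torusCocycle_zero_left (β : Fin m → ℤ) : torusCocycle q 0 β = 1 := by
  simp [torusCocycle]

@[simp]
theorem torusCocycle_zero_right (α : Fin m → ℤ) : torusCocycle q α 0 = 1 := by
  simp [torusCocycle]

theorem torusCocycle_sub_left (hq : ∀ i j, i < j → q i j ≠ 0) (α α' β : Fin m → ℤ) :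
    torusCocycle q (α - α') β = torusCocycle q α β / torusCocycle q α' β := by
  rw [eq_div_iff (torusCocycle_ne_zero hq _ _), ← torusCocycle_add_left hq, sub_add_cancel]

theorem torusCocycle_sub_right (hq : ∀ i j, i < j → q i j ≠ 0) (α β β' : Fin m → ℤ) :
    torusCocycle q α (β - β') = torusCocycle q α β / torusCocycle q α β' := by
  rw [eq_div_iff (torusCocycle_ne_zero hq _ _), ← torusCocycle_add_right hq, sub_add_cancel]

theorem torusCocycle_unitExp_left (j : Fin m) (β : Fin m → ℤ) :
    torusCocycle q (unitExp j) β = ∏ l, upperParam q l j ^ β l := by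
  rw [torusCocycle, Finset.prod_eq_single j]
  · simp
  · intro i _ hi
    simp [hi]
  · simp

theorem torusCocycle_unitExp (j l : Fin m) :
    torusCocycle q (unitExp j) (unitExp l) = upperParam q l j := by
  rw [torusCocycle_unitExp_left, Finset.prod_eq_single l]
  · simp
  · intro i _ hi
    simp [hi]
  · simp

variable (q) in
/-- The scalar in `y j * y ^ b * (y i)⁻¹ = letterScalar q i j b • y ^ (b + e j - e i)`. -/
def letterScalar (i j : Fin m) (b : Fin m → ℤ) : ℂ :=
  torusCocycle q (unitExp j) b * (torusCocycle q (b + unitExp j - unitExp i) (unitExp i))⁻¹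

/-- The number of occurrences of every index in a word. -/
def wordContent (ν : List (Fin m)) : Fin m → ℤ := (ν.map unitExp).sum

variable (q) in
/-- The scalar in `y ^ γ * y ^ b * (y ^ ρ)⁻¹ = wordScalar q γ ρ b • y ^ (b + γ - ρ)`. -/
def wordScalar (γ ρ b : Fin m → ℤ) : ℂ :=
  torusCocycle q γ b * (torusCocycle q (b + γ - ρ) ρ)⁻¹

theorem inversionWeight_nil : inversionWeight q [] = 1 :=
  Finset.prod_eq_one fun p _ => p.1.elim0

theorem inversionWeight_cons_eq_prod (x : Fin m) (ν : List (Fin m)) :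
    inversionWeight q (x :: ν) = (ν.map fun y => upperParam q y x).prod * inversionWeight q ν := by
  have h : ∀ ν : List (Fin m), inversionWeight q ν = ∏ a : Fin ν.length, ∏ b : Fin ν.length,
      if a < b ∧ ν.get b < ν.get a then q (ν.get b) (ν.get a) else 1 := by
    intro ν
    rw [inversionWeight, Finset.prod_filter, ← Finset.univ_product_univ, Finset.prod_product]
  rw [h, h, ← Fin.prod_univ_fun_getElem]
  change (∏ a : Fin (ν.length + 1), ∏ b : Fin (ν.length + 1), _) = _
  rw [Fin.prod_univ_succ]
  congr 1
  · rw [Fin.prod_univ_succ]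
    simp [upperParam]
  · refine Finset.prod_congr rfl fun a _ => ?_
    rw [Fin.prod_univ_succ]
    simp

/-- The inversion weight is the scalar that sorts a product of generators: moving a leading y_x into
the sorted monomial of the rest costs the cocycle. -/
theorem inversionWeight_cons (hq : ∀ i j, i < j → q i j ≠ 0) (x : Fin m) (ν : List (Fin m)) :
    inversionWeight q (x :: ν) =
      torusCocycle q (unitExp x) (wordContent ν) * inversionWeight q ν := by
  rw [inversionWeight_cons_eq_prod]
  congr 1
  induction ν with
  | nil => simp [wordContent]
  | cons y ν ih =>
    have : wordContent (y :: ν) = unitExp y + wordContent ν := by simp [wordContent]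
    rw [List.map_cons, List.prod_cons, ih, this, torusCocycle_add_right hq, torusCocycle_unitExp]

theorem wordContent_cons (x : Fin m) (ν : List (Fin m)) :
    wordContent (x :: ν) = unitExp x + wordContent ν := by
  simp [wordContent]

/-- One more letter multiplies by y_j on the left and y_i⁻¹ on the right. Both sides are the scalar
so produced, computed for the whole word or letter by letter; they agree because the cocycle is
bimultiplicative. -/
theorem wordScalar_cons (hq : ∀ i j, i < j → q i j ≠ 0) (i j : Fin m) (w : List (Fin m × Fin m))
    (b : Fin m → ℤ) :
    wordScalar q (wordContent (((i, j) :: w).map Prod.snd))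
        (wordContent (((i, j) :: w).map Prod.fst)) b * wordWeight q ((i, j) :: w) =
      letterScalar q i j (b + wordContent (w.map Prod.snd) - wordContent (w.map Prod.fst)) *
        (wordScalar q (wordContent (w.map Prod.snd)) (wordContent (w.map Prod.fst)) b *
          wordWeight q w) := by
  have h0 := torusCocycle_ne_zero hq
  simp only [wordWeight, List.map_cons, inversionWeight_cons hq, wordContent_cons, wordScalar,
    letterScalar, torusCocycle_add_left hq, torusCocycle_add_right hq, torusCocycle_sub_left hq,
    torusCocycle_sub_right hq, mul_inv]
  generalize (inversionWeight q (w.map Prod.fst))⁻¹ = u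
  field_simp [h0]

end Torus

/-! ### Graded operators -/

section GradedOperators

variable {G R : Type*} [Ring R] [Algebra ℂ R]

/-- The families of elements of `R` indexed by `G`. -/
def GradedFamily (G R : Type*) : Type _ := G → R

instance : AddCommGroup (GradedFamily G R) := inferInstanceAs (AddCommGroup (G → R))

instance : Module ℂ (GradedFamily G R) := inferInstanceAs (Module ℂ (G → R))

/-- The family concentrated at `b`. -/
def placeAt [DecidableEq G] (R : Type*) [Ring R] [Algebra ℂ R] (b : G) :
    R →ₗ[ℂ] GradedFamily G R :=
  LinearMap.single ℂ (fun _ : G => R) b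

theorem placeAt_injective [DecidableEq G] (b : G) : Function.Injective (placeAt R b) :=
  Pi.single_injective (M := fun _ : G => R) b

variable [AddCommGroup G]

/-- The operator on families that multiplies the entry at `b` by `g b` and moves it to `b + d`. -/
def gradedOp (d : G) (g : G → R) : Module.End ℂ (GradedFamily G R) where
  toFun f b := g (b - d) * f (b - d)
  map_add' _ _ := funext fun _ => mul_add _ _ _
  map_smul' _ _ := funext fun _ => mul_smul_comm _ _ _

theorem gradedOp_apply (d : G) (g : G → R) (f : GradedFamily G R) (b : G) :
    gradedOp d g f b = g (b - d) * f (b - d) := rfl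

theorem gradedOp_mul (d d' : G) (g g' : G → R) :
    gradedOp d g * gradedOp d' g' = gradedOp (d' + d) fun b => g (b + d') * g' b := by
  refine LinearMap.ext fun f => funext fun b => ?_
  rw [Module.End.mul_apply, gradedOp_apply, gradedOp_apply, gradedOp_apply, mul_assoc]
  rw [show b - d - d' = b - (d' + d) by abel, show b - d = b - (d' + d) + d' by abel]

theorem gradedOp_add (d : G) (g g' : G → R) :
    gradedOp d (g + g') = gradedOp d g + gradedOp d g' :=
  LinearMap.ext fun _ => funext fun _ => add_mul _ _ _

/-- `gradedOp d` as an additive homomorphism. -/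
def gradedOpHom (d : G) : (G → R) →+ Module.End ℂ (GradedFamily G R) :=
  AddMonoidHom.mk' (gradedOp d) (gradedOp_add d)

theorem gradedOp_sub (d : G) (g g' : G → R) :
    gradedOp d g - gradedOp d g' = gradedOp d (g - g') :=
  ((gradedOpHom d).map_sub g g').symm

theorem gradedOp_neg (d : G) (g : G → R) : -gradedOp d g = gradedOp d (-g) :=
  ((gradedOpHom d).map_neg g).symm

theorem gradedOp_sum {κ : Type*} (s : Finset κ) (d : G) (g : κ → G → R) :
    ∑ k ∈ s, gradedOp d (g k) = gradedOp d (∑ k ∈ s, g k) :=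
  (map_sum (gradedOpHom d) g s).symm

theorem gradedOp_placeAt [DecidableEq G] (d : G) (g : G → R) (b : G) (x : R) :
    gradedOp d g (placeAt R b x) = placeAt R (b + d) (g b * x) := by
  funext c
  change g (c - d) * Pi.single (M := fun _ : G => R) b x (c - d) =
    Pi.single (M := fun _ : G => R) (b + d) (g b * x) c
  by_cases h : c = b + d
  · subst h
    simp
  · have : c - d ≠ b := fun h' => h (by rw [← h']; abel)
    simp [h, this]

end GradedOperators

/-! ### The twisted matrix and its commuting rows -/

section TwistedMatrix

variable {m : ℕ} {R : Type*} [Ring R] [Algebra ℂ R]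

/-- The matrix `A` twisted by the quantum torus: `a i j ⊗ y j * _ * (y i)⁻¹`. -/
def twistedMatrix (q : Fin m → Fin m → ℂ) (a : Matrix (Fin m) (Fin m) R) :
    Matrix (Fin m) (Fin m) (Module.End ℂ (GradedFamily (Fin m → ℤ) R)) :=
  Matrix.of fun i j => gradedOp (unitExp j - unitExp i) fun b => letterScalar q i j b • a i j

variable {q : Fin m → Fin m → ℂ}

/-- With `upperParam` equal to 1 off the range l < j, the three relations become one formula, so the
commutation of rows needs no cases on the columns. -/
theorem IsQCartierFoata.rel (hq : ∀ i j, i < j → q i j ≠ 0) {a : Matrix (Fin m) (Fin m) R}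
    (ha : IsQCartierFoata q a) {i j : Fin m} (hij : i < j) (k l : Fin m) :
    a j l * a i k = ((upperParam q k l)⁻¹ * (upperParam q l k * q i j)) • (a i k * a j l) := by
  rcases lt_trichotomy k l with h | rfl | h
  · have := ha.rel_lt i j k l hij h
    simp only [upperParam, if_pos h, if_neg h.not_gt, one_mul]
    rw [mul_smul, ← this, smul_smul, inv_mul_cancel₀ (hq _ _ h), one_smul]
  · simpa [upperParam] using ha.rel_eq i j k hij
  · simpa [upperParam, h, h.not_gt, mul_comm] using ha.rel_gt i j k l hij h

/-- Different rows of the twisted matrix commute. -/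
theorem twistedMatrix_commute (hq : ∀ i j, i < j → q i j ≠ 0) {a : Matrix (Fin m) (Fin m) R}
    (ha : IsQCartierFoata q a) {i j : Fin m} (hij : i ≠ j) (k l : Fin m) :
    Commute (twistedMatrix q a i k) (twistedMatrix q a j l) := by
  wlog h : i < j generalizing i j k l
  · exact (this hij.symm l k (lt_of_le_of_ne (not_lt.1 h) hij.symm)).symm
  have h0 := torusCocycle_ne_zero hq
  rw [commute_iff_eq]
  simp only [twistedMatrix, Matrix.of_apply]
  rw [gradedOp_mul, gradedOp_mul, add_comm (unitExp l - unitExp j)]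
  congr 1
  funext b
  rw [smul_mul_smul_comm, smul_mul_smul_comm, ha.rel hq h k l, smul_smul]
  congr 1
  have hij' : q i j = torusCocycle q (unitExp j) (unitExp i) := by
    rw [torusCocycle_unitExp, upperParam, if_pos h]
  have hji : torusCocycle q (unitExp i) (unitExp j) = 1 := by
    rw [torusCocycle_unitExp, upperParam, if_neg h.not_gt]
  rw [← torusCocycle_unitExp, ← torusCocycle_unitExp, hij']
  simp only [letterScalar, torusCocycle_add_left hq, torusCocycle_add_right hq,
    torusCocycle_sub_left hq, torusCocycle_sub_right hq, hji]
  field_simp [h0]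

end TwistedMatrix

/-! ### Weighted substitution -/

section WeightedSubstitution

variable {m : ℕ} (q : Fin m → Fin m → ℂ)

theorem applyWeight_of (w : FreeMonoid (Fin m × Fin m)) :
    applyWeight q (MonoidAlgebra.of ℂ _ w) =
      wordWeight q (FreeMonoid.toList w) • MonoidAlgebra.of ℂ _ w := by
  rw [applyWeight, MonoidAlgebra.of_apply, MonoidAlgebra.coeff_single, Finsupp.sum_single_index]
  · simp
  · simp

theorem applyWeight_add (f g : NCPoly m) :
    applyWeight q (f + g) = applyWeight q f + applyWeight q g := by
  rw [applyWeight, MonoidAlgebra.coeff_add]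
  exact Finsupp.sum_add_index' (by simp) (by simp [mul_add])

theorem applyWeight_smul (c : ℂ) (f : NCPoly m) :
    applyWeight q (c • f) = c • applyWeight q f := by
  rw [applyWeight, MonoidAlgebra.coeff_smul, Finsupp.sum_smul_index (by simp), applyWeight,
    Finsupp.smul_sum]
  simp [mul_left_comm]

/-- `applyWeight` as a linear map. -/
def applyWeightHom : NCPoly m →ₗ[ℂ] NCPoly m where
  toFun := applyWeight q
  map_add' := applyWeight_add q
  map_smul' := applyWeight_smul q

theorem qDet_eq {k : ℕ} (B : Matrix (Fin k) (Fin k) (NCPoly m)) :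
    qDet q B = applyWeight q (colDet B) := rfl

theorem substEntries_of {R : Type*} [Ring R] [Algebra ℂ R] (a : Matrix (Fin m) (Fin m) R)
    (w : FreeMonoid (Fin m × Fin m)) : substEntries a (MonoidAlgebra.of ℂ _ w) =
      ((FreeMonoid.toList w).map fun p => a p.1 p.2).prod := by
  rw [substEntries, MonoidAlgebra.lift_of, FreeMonoid.lift_apply]

theorem substEntries_genericMatrix {R : Type*} [Ring R] [Algebra ℂ R]
    (a : Matrix (Fin m) (Fin m) R) (i j : Fin m) : substEntries a (genericMatrix m i j) = a i j := by
  rw [genericMatrix, Matrix.of_apply, substEntries_of]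
  simp

variable {q} {R V : Type*} [Ring R] [Algebra ℂ R] [AddCommGroup V] [Module ℂ V]

/-- The action is prescribed only on degrees in H, a set closed under all shifts. This lets the same
statement serve the twisted matrix on all degrees and its Schur complement, known only on degrees of
coordinate sum 0. -/
theorem substEntries_of_place (hq : ∀ i j, i < j → q i j ≠ 0)
    (T : Matrix (Fin m) (Fin m) (Module.End ℂ V)) (c : Matrix (Fin m) (Fin m) R)
    (place : (Fin m → ℤ) → R →ₗ[ℂ] V) (H : Set (Fin m → ℤ))
    (hH : ∀ i j, ∀ b ∈ H, b + unitExp j - unitExp i ∈ H)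
    (hT : ∀ i j, ∀ b ∈ H, ∀ x, T i j (place b x) =
      place (b + unitExp j - unitExp i) (letterScalar q i j b • (c i j * x)))
    (w : List (Fin m × Fin m)) {b : Fin m → ℤ} (hb : b ∈ H) (x : R) :
    b + wordContent (w.map Prod.snd) - wordContent (w.map Prod.fst) ∈ H ∧
    (w.map fun p => T p.1 p.2).prod (place b x) =
      place (b + wordContent (w.map Prod.snd) - wordContent (w.map Prod.fst))
        ((wordScalar q (wordContent (w.map Prod.snd)) (wordContent (w.map Prod.fst)) b *
          wordWeight q w) • ((w.map fun p => c p.1 p.2).prod * x)) := by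
  induction w with
  | nil => simp [wordContent, wordScalar, wordWeight, inversionWeight_nil, hb]
  | cons p w ih =>
    obtain ⟨i, j⟩ := p
    obtain ⟨ih1, ih2⟩ := ih
    have hd : b + wordContent (((i, j) :: w).map Prod.snd) -
        wordContent (((i, j) :: w).map Prod.fst) =
        b + wordContent (w.map Prod.snd) - wordContent (w.map Prod.fst) +
          unitExp j - unitExp i := by
      simp only [List.map_cons, wordContent_cons]
      abel
    rw [hd]
    refine ⟨hH i j _ ih1, ?_⟩
    rw [List.map_cons, List.prod_cons, Module.End.mul_apply, ih2, hT i j _ ih1,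
      wordScalar_cons hq, List.map_cons, List.prod_cons, mul_smul_comm, smul_smul, mul_assoc]

/-- The span of the words of degree `γ`. -/
def homogeneousPart {Γ : Type*} [AddCommGroup Γ] (deg : Fin m × Fin m → Γ) (γ : Γ) :
    Submodule ℂ (NCPoly m) :=
  Submodule.span ℂ
    (MonoidAlgebra.of ℂ _ '' {w | ((FreeMonoid.toList w).map deg).sum = γ})

/-! ### Homogeneity of determinants -/

section Homogeneous

variable {Γ : Type*} [AddCommGroup Γ] {deg : Fin m × Fin m → Γ}

theorem one_mem_homogeneousPart : (1 : NCPoly m) ∈ homogeneousPart deg 0 :=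
  Submodule.subset_span ⟨1, by simp, map_one _⟩

theorem genericMatrix_mem_homogeneousPart (i j : Fin m) :
    genericMatrix m i j ∈ homogeneousPart deg (deg (i, j)) :=
  Submodule.subset_span ⟨FreeMonoid.of (i, j), by simp, rfl⟩

theorem mul_mem_homogeneousPart {γ γ' : Γ} {f g : NCPoly m} (hf : f ∈ homogeneousPart deg γ)
    (hg : g ∈ homogeneousPart deg γ') : f * g ∈ homogeneousPart deg (γ + γ') := by
  have := Submodule.mul_mem_mul hf hg
  rw [homogeneousPart, homogeneousPart, Submodule.span_mul_span] at this
  refine Submodule.span_mono ?_ this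
  rintro _ ⟨_, ⟨u, hu, rfl⟩, _, ⟨v, hv, rfl⟩, rfl⟩
  refine ⟨u * v, ?_, map_mul _ _ _⟩
  rw [Set.mem_ofPred_eq] at *
  rw [FreeMonoid.toList_mul, List.map_append, List.sum_append, hu, hv]

theorem prod_ofFn_mem_homogeneousPart {k : ℕ} (f : Fin k → NCPoly m) (γ : Fin k → Γ)
    (h : ∀ p, f p ∈ homogeneousPart deg (γ p)) :
    (List.ofFn f).prod ∈ homogeneousPart deg (∑ p, γ p) := by
  induction k with
  | zero => simpa using one_mem_homogeneousPart
  | succ k ih =>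
    rw [List.ofFn_succ, List.prod_cons, Fin.sum_univ_succ]
    exact mul_mem_homogeneousPart (h 0) (ih _ _ fun p => h p.succ)

/-- Along a permutation the row and column degrees sum to the same total, whatever the permutation.
-/
theorem colDet_mem_homogeneousPart {k : ℕ} (B : Matrix (Fin k) (Fin k) (NCPoly m))
    (row col : Fin k → Γ) (h : ∀ i j, B i j ∈ homogeneousPart deg (col j - row i)) :
    colDet B ∈ homogeneousPart deg (∑ j, col j - ∑ i, row i) := by
  refine Submodule.sum_mem _ fun σ _ => ?_
  rw [← zsmul_eq_mul]
  refine zsmul_mem ?_ _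
  have := prod_ofFn_mem_homogeneousPart (fun p => B (σ p) p) (fun p => col p - row (σ p))
    fun p => h _ _
  rwa [Finset.sum_sub_distrib, Equiv.sum_comp σ row] at this

/-- On words of one degree the target b' and the scalar s are constant, so they factor out and only
the word weights remain inside the polynomial. -/
theorem substEntries_place_of_mem (hq : ∀ i j, i < j → q i j ≠ 0)
    (T : Matrix (Fin m) (Fin m) (Module.End ℂ V)) (c : Matrix (Fin m) (Fin m) R)
    (place : (Fin m → ℤ) → R →ₗ[ℂ] V) (H : Set (Fin m → ℤ))
    (hH : ∀ i j, ∀ b ∈ H, b + unitExp j - unitExp i ∈ H)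
    (hT : ∀ i j, ∀ b ∈ H, ∀ x, T i j (place b x) =
      place (b + unitExp j - unitExp i) (letterScalar q i j b • (c i j * x)))
    {b : Fin m → ℤ} (hb : b ∈ H) {γ : Γ} {s : ℂ} {b' : Fin m → ℤ}
    (hγ : ∀ w : List (Fin m × Fin m), (w.map deg).sum = γ →
      b + wordContent (w.map Prod.snd) - wordContent (w.map Prod.fst) = b' ∧
      wordScalar q (wordContent (w.map Prod.snd)) (wordContent (w.map Prod.fst)) b = s)
    {f : NCPoly m} (hf : f ∈ homogeneousPart deg γ) (x : R) :
    substEntries T f (place b x) =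
      place b' (s • (substEntries c (applyWeight q f) * x)) := by
  induction hf using Submodule.span_induction with
  | mem f hf =>
    obtain ⟨w, hw, rfl⟩ := hf
    obtain ⟨h1, h2⟩ := hγ _ hw
    rw [substEntries_of, (substEntries_of_place hq T c place H hH hT _ hb x).2, h1, h2,
      applyWeight_of, map_smul (substEntries c), substEntries_of, smul_mul_assoc, smul_smul, map_smul]
  | zero =>
    have : applyWeight q (0 : NCPoly m) = 0 := (applyWeightHom q).map_zero
    simp [this]
  | add f g _ _ hf hg =>
    rw [map_add, LinearMap.add_apply, hf, hg, applyWeight_add, map_add, add_mul, smul_add, map_add]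
  | smul a f _ hf =>
    rw [map_smul, LinearMap.smul_apply, hf, applyWeight_smul, map_smul (substEntries c),
      smul_mul_assoc, ← map_smul, smul_comm]

end Homogeneous

end WeightedSubstitution

/-! ### Sylvester's identity over an algebra in which the block can be inverted -/

section BlockTorus

variable {n r : ℕ} {q : Fin (n + r) → Fin (n + r) → ℂ}

theorem unitExp_natAdd (j : Fin r) :
    unitExp (Fin.natAdd n j) = Fin.append (0 : Fin n → ℤ) (unitExp j) := by
  funext k
  refine Fin.addCases (fun k => ?_) (fun k => ?_) k
  · have : Fin.castAdd r k ≠ Fin.natAdd n j := by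
      simp only [ne_eq, Fin.ext_iff, Fin.val_castAdd, Fin.val_natAdd]
      omega
    rw [Fin.append_left, unitExp, Pi.single_eq_of_ne this, Pi.zero_apply]
  · simp [unitExp, Pi.single_apply]

theorem append_zero_add (b b' : Fin r → ℤ) : Fin.append (0 : Fin n → ℤ) (b + b') =
    Fin.append (0 : Fin n → ℤ) b + Fin.append (0 : Fin n → ℤ) b' := by
  funext k
  refine Fin.addCases (fun k => ?_) (fun k => ?_) k <;> simp

theorem append_zero_sub (b b' : Fin r → ℤ) : Fin.append (0 : Fin n → ℤ) (b - b') =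
    Fin.append (0 : Fin n → ℤ) b - Fin.append (0 : Fin n → ℤ) b' := by
  funext k
  refine Fin.addCases (fun k => ?_) (fun k => ?_) k <;> simp

theorem append_zero_zero : Fin.append (0 : Fin n → ℤ) (0 : Fin r → ℤ) = 0 := by
  funext k
  refine Fin.addCases (fun k => ?_) (fun k => ?_) k <;> simp

theorem torusCocycle_append_left_right (α : Fin n → ℤ) (b : Fin r → ℤ) :
    torusCocycle q (Fin.append α 0) (Fin.append 0 b) = 1 := by
  refine Finset.prod_eq_one fun j _ => Finset.prod_eq_one fun l _ => ?_
  refine Fin.addCases (fun j => ?_) (fun j => by simp) j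
  refine Fin.addCases (fun l => by simp) (fun l => ?_) l
  have : ¬ Fin.natAdd n l < Fin.castAdd r j := by
    simp only [Fin.lt_def, Fin.val_castAdd, Fin.val_natAdd]
    omega
  simp [upperParam, this]

/-- By `hind` the parameter q_lj depends only on l when l ≤ n < j, so its exponents add up to α_l ∑
b_j = 0. -/
theorem torusCocycle_append_right_left
    (hind : ∀ (i : Fin n) (j j' : Fin r),
      q (Fin.castAdd r i) (Fin.natAdd n j) = q (Fin.castAdd r i) (Fin.natAdd n j'))
    (hq : ∀ i j, i < j → q i j ≠ 0)
    (α : Fin n → ℤ) (b : Fin r → ℤ) (hb : ∑ j, b j = 0) :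
    torusCocycle q (Fin.append 0 b) (Fin.append α 0) = 1 := by
  rcases isEmpty_or_nonempty (Fin r) with h | ⟨⟨j₀⟩⟩
  · have : b = 0 := Subsingleton.elim _ _
    rw [this, append_zero_zero, torusCocycle_zero_left]
  · have hlt : ∀ (l : Fin n) (j : Fin r), Fin.castAdd r l < Fin.natAdd n j := by
      intro l j
      simp only [Fin.lt_def, Fin.val_castAdd, Fin.val_natAdd]
      omega
    have hpow : ∀ (x : ℂ), x ≠ 0 → ∀ (s : Finset (Fin r)) (e : Fin r → ℤ),
        ∏ j ∈ s, x ^ e j = x ^ ∑ j ∈ s, e j := by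
      intro x hx s e
      classical
      induction s using Finset.induction_on with
      | empty => simp
      | insert a s ha ih => rw [Finset.prod_insert ha, Finset.sum_insert ha, zpow_add₀ hx, ih]
    rw [torusCocycle, Finset.prod_comm, Fin.prod_univ_add]
    simp only [Fin.prod_univ_add, Fin.append_left, Fin.append_right, Pi.zero_apply, zero_mul,
      mul_zero, zpow_zero, Finset.prod_const_one, one_mul, mul_one]
    refine Finset.prod_eq_one fun l _ => ?_
    have h1 : ∀ j, upperParam q (Fin.castAdd r l) (Fin.natAdd n j) =
        q (Fin.castAdd r l) (Fin.natAdd n j₀) := fun j => by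
      rw [upperParam, if_pos (hlt l j), hind l j j₀]
    simp only [h1]
    rw [hpow _ (hq _ _ (hlt l j₀)), ← Finset.sum_mul, hb, zero_mul, zpow_zero]

theorem torusCocycle_append_right_right (b b' : Fin r → ℤ) :
    torusCocycle q (Fin.append 0 b) (Fin.append 0 b') =
      torusCocycle (fun i j => q (Fin.natAdd n i) (Fin.natAdd n j)) b b' := by
  simp only [torusCocycle, Fin.prod_univ_add, Fin.append_left, Fin.append_right, Pi.zero_apply,
    zero_mul, mul_zero, zpow_zero, Finset.prod_const_one, one_mul, upperParam,
    Fin.natAdd_lt_natAdd_iff]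

theorem letterScalar_append (i j : Fin r) (b : Fin r → ℤ) :
    letterScalar q (Fin.natAdd n i) (Fin.natAdd n j) (Fin.append 0 b) =
      letterScalar (fun i j => q (Fin.natAdd n i) (Fin.natAdd n j)) i j b := by
  simp only [letterScalar, unitExp_natAdd, ← append_zero_add, ← append_zero_sub,
    torusCocycle_append_right_right]

/-- The degree that records the difference of the column and the row content of a word, and the row
content beyond `n`. -/
def blockDeg (p : Fin (n + r) × Fin (n + r)) : (Fin (n + r) → ℤ) × (Fin r → ℤ) :=
  (unitExp p.2 - unitExp p.1, fun k => unitExp p.1 (Fin.natAdd n k))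

theorem sum_map_blockDeg (w : List (Fin (n + r) × Fin (n + r))) :
    (w.map blockDeg).sum = (wordContent (w.map Prod.snd) - wordContent (w.map Prod.fst),
      fun k => wordContent (w.map Prod.fst) (Fin.natAdd n k)) := by
  induction w with
  | nil => rfl
  | cons p w ih =>
    rw [List.map_cons, List.sum_cons, ih, List.map_cons, List.map_cons, wordContent_cons,
      wordContent_cons, blockDeg, Prod.mk_add_mk]
    congr 1
    abel

theorem eq_append_add (c : Fin (n + r) → ℤ) (d : Fin r → ℤ)
    (h : (fun k => c (Fin.natAdd n k)) = d) :
    c = Fin.append (fun k => c (Fin.castAdd r k)) 0 + Fin.append 0 d := by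
  subst h
  funext k
  refine Fin.addCases (fun k => ?_) (fun k => ?_) k <;> simp

/-- Row and column contents agree and live in the first block; they vary from word to word, but the
cocycle between them and the degrees (0, b) is trivial on both sides. -/
theorem wordScalar_of_blockDeg_eq_zero (hind : ∀ (i : Fin n) (j j' : Fin r),
      q (Fin.castAdd r i) (Fin.natAdd n j) = q (Fin.castAdd r i) (Fin.natAdd n j'))
    (hq : ∀ i j, i < j → q i j ≠ 0) (b : Fin r → ℤ) (hb : ∑ j, b j = 0)
    (w : List (Fin (n + r) × Fin (n + r))) (hw : (w.map blockDeg).sum = 0) :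
    Fin.append 0 b + wordContent (w.map Prod.snd) - wordContent (w.map Prod.fst) =
      Fin.append 0 b ∧
    wordScalar q (wordContent (w.map Prod.snd)) (wordContent (w.map Prod.fst)) (Fin.append 0 b) =
      1 := by
  rw [sum_map_blockDeg, Prod.mk_eq_zero] at hw
  obtain ⟨h1, h2⟩ := hw
  have h3 := eq_append_add _ _ h2
  rw [append_zero_zero, add_zero] at h3
  rw [sub_eq_zero.1 h1]
  refine ⟨add_sub_cancel_right _ _, ?_⟩
  rw [wordScalar, add_sub_cancel_right, h3, torusCocycle_append_left_right,
    torusCocycle_append_right_left hind hq _ b hb, inv_one, mul_one]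

/-- The contents are α + e_{n+j} and α + e_{n+i} with a common α in the first block. The
contributions of α are trivial, so a whole word of the bordered determinant scales like the single
letter a_{n+i,n+j}. -/
theorem wordScalar_of_blockDeg_eq (hind : ∀ (i : Fin n) (j j' : Fin r),
      q (Fin.castAdd r i) (Fin.natAdd n j) = q (Fin.castAdd r i) (Fin.natAdd n j'))
    (hq : ∀ i j, i < j → q i j ≠ 0) (b : Fin r → ℤ) (hb : ∑ j, b j = 0) (i j : Fin r)
    (w : List (Fin (n + r) × Fin (n + r)))
    (hw : (w.map blockDeg).sum =
      (unitExp (Fin.natAdd n j) - unitExp (Fin.natAdd n i), unitExp i)) :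
    Fin.append 0 b + wordContent (w.map Prod.snd) - wordContent (w.map Prod.fst) =
      Fin.append 0 b + unitExp (Fin.natAdd n j) - unitExp (Fin.natAdd n i) ∧
    wordScalar q (wordContent (w.map Prod.snd)) (wordContent (w.map Prod.fst)) (Fin.append 0 b) =
      letterScalar q (Fin.natAdd n i) (Fin.natAdd n j) (Fin.append 0 b) := by
  rw [sum_map_blockDeg, Prod.mk_inj] at hw
  obtain ⟨h1, h2⟩ := hw
  have h3 := eq_append_add _ _ h2
  rw [← unitExp_natAdd] at h3
  generalize (fun k => wordContent (w.map Prod.fst) (Fin.castAdd r k)) = α at h3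
  rw [h3, sub_eq_iff_eq_add] at h1
  have h4 : wordContent (w.map Prod.snd) = Fin.append α 0 + unitExp (Fin.natAdd n j) := by
    rw [h1]
    abel
  have h5 : Fin.append 0 b + (Fin.append α 0 + unitExp (Fin.natAdd n j)) -
      (Fin.append α 0 + unitExp (Fin.natAdd n i)) =
      Fin.append 0 b + unitExp (Fin.natAdd n j) - unitExp (Fin.natAdd n i) := by abel
  have h6 : Fin.append 0 b + unitExp (Fin.natAdd n j) - unitExp (Fin.natAdd n i) =
      Fin.append 0 (b + unitExp j - unitExp i) := by
    rw [append_zero_sub, append_zero_add, unitExp_natAdd, unitExp_natAdd]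
  rw [h3, h4]
  refine ⟨h5, ?_⟩
  rw [wordScalar, letterScalar, h5, torusCocycle_add_left hq, torusCocycle_append_left_right,
    one_mul, torusCocycle_add_right hq]
  congr 2
  rw [h6, torusCocycle_append_right_left hind hq, one_mul]
  simp [Finset.sum_add_distrib, Finset.sum_sub_distrib, hb]

end BlockTorus

/-! ### Determinants acting on concentrated families -/

section SylvesterOfSolvable

variable {R : Type*} [Ring R] [Algebra ℂ R]

theorem twistedMatrix_placeAt {m : ℕ} (q : Fin m → Fin m → ℂ) (a : Matrix (Fin m) (Fin m) R)
    (i j : Fin m) (b : Fin m → ℤ) (x : R) :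
    twistedMatrix q a i j (placeAt R b x) =
      placeAt R (b + unitExp j - unitExp i) (letterScalar q i j b • (a i j * x)) := by
  rw [twistedMatrix, Matrix.of_apply, gradedOp_placeAt, add_sub_assoc, smul_mul_assoc]

theorem sum_map_sub_unitExp {m : ℕ} (w : List (Fin m × Fin m)) :
    (w.map fun p => (unitExp p.2 - unitExp p.1 : Fin m → ℤ)).sum =
      wordContent (w.map Prod.snd) - wordContent (w.map Prod.fst) := by
  induction w with
  | nil => rfl
  | cons p w ih =>
    rw [List.map_cons, List.sum_cons, ih, List.map_cons, List.map_cons, wordContent_cons,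
      wordContent_cons]
    abel

/-- All words of det(1 - T) have equal row and column contents, and in degree 0 such a word has
scalar 1. -/
theorem colDet_one_sub_placeAt {m : ℕ} {q : Fin m → Fin m → ℂ} {V : Type*} [AddCommGroup V]
    [Module ℂ V] (hq : ∀ i j, i < j → q i j ≠ 0) (T : Matrix (Fin m) (Fin m) (Module.End ℂ V))
    (c : Matrix (Fin m) (Fin m) R) (place : (Fin m → ℤ) → R →ₗ[ℂ] V)
    (hT : ∀ i j b, ∑ k, b k = 0 → ∀ x, T i j (place b x) =
      place (b + unitExp j - unitExp i) (letterScalar q i j b • (c i j * x))) (x : R) :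
    (colDet (1 - T) : Module.End ℂ V) (place 0 x) = place 0 (qDetOneSub q c * x) := by
  have h1 : colDet (1 - T) = substEntries T (colDet (1 - genericMatrix m)) := by
    rw [map_colDet]
    congr 1
    ext1 i j
    rw [Matrix.map_apply, Matrix.sub_apply, Matrix.sub_apply, map_sub, substEntries_genericMatrix,
      Matrix.one_apply, Matrix.one_apply]
    split_ifs <;> simp
  have hmem : colDet (1 - genericMatrix m) ∈
      homogeneousPart (fun p : Fin m × Fin m => (unitExp p.2 - unitExp p.1 : Fin m → ℤ)) 0 := by
    have := colDet_mem_homogeneousPart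
      (deg := fun p : Fin m × Fin m => (unitExp p.2 - unitExp p.1 : Fin m → ℤ))
      (1 - genericMatrix m) unitExp unitExp fun i j => ?_
    · rwa [sub_self] at this
    · refine Submodule.sub_mem _ ?_ (genericMatrix_mem_homogeneousPart i j)
      rw [Matrix.one_apply]
      split_ifs with h
      · rw [h, sub_self]
        exact one_mem_homogeneousPart
      · exact Submodule.zero_mem _
  rw [h1, substEntries_place_of_mem hq T c place {b | ∑ k, b k = 0} ?_
    (fun i j b hb x => hT i j b hb x) (b := 0) (by simp) (s := 1) (b' := 0) ?_ hmem, one_smul]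
  · rfl
  · intro i j b hb
    rw [Set.mem_ofPred_eq] at *
    simp [Finset.sum_add_distrib, Finset.sum_sub_distrib, hb]
  · intro w hw
    rw [sum_map_sub_unitExp, sub_eq_zero] at hw
    rw [hw, wordScalar]
    simp

variable {n r : ℕ} {q : Fin (n + r) → Fin (n + r) → ℂ}

theorem one_submatrix_mem (i j : Fin n) :
    (1 - (genericMatrix (n + r)).submatrix (Fin.castAdd r) (Fin.castAdd r) :
      Matrix (Fin n) (Fin n) (NCPoly (n + r))) i j ∈ homogeneousPart blockDeg
        ((unitExp (Fin.castAdd r j), 0) - (unitExp (Fin.castAdd r i), 0)) := by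
  have h0 : (fun k : Fin r => unitExp (Fin.castAdd r i) (Fin.natAdd n k)) = 0 := by
    funext k
    have : Fin.natAdd n k ≠ Fin.castAdd r i := by
      simp only [ne_eq, Fin.ext_iff, Fin.val_castAdd, Fin.val_natAdd]
      omega
    simp [unitExp, Pi.single_eq_of_ne this]
  refine Submodule.sub_mem _ ?_ ?_
  · rw [Matrix.one_apply]
    split_ifs with h
    · rw [h, sub_self]
      exact one_mem_homogeneousPart
    · exact Submodule.zero_mem _
  · have := genericMatrix_mem_homogeneousPart (deg := blockDeg)
      (Fin.castAdd r i) (Fin.castAdd r j)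
    rw [blockDeg] at this
    simp only [h0] at this
    simpa using this

end SylvesterOfSolvable

/-! ### The Schur complement of the twisted matrix -/

section SylvesterOfSolvable

variable {R : Type*} [Ring R] [Algebra ℂ R] {n r : ℕ} {q : Fin (n + r) → Fin (n + r) → ℂ}

theorem borderedMatrix_castAdd_castAdd (i j : Fin r) (k l : Fin n) :
    borderedMatrix n i j (Fin.castAdd 1 k) (Fin.castAdd 1 l) =
      (1 - (genericMatrix (n + r)).submatrix (Fin.castAdd r) (Fin.castAdd r) :
        Matrix (Fin n) (Fin n) (NCPoly (n + r))) k l := by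
  simp [borderedMatrix]

theorem borderedMatrix_castAdd_natAdd (i j : Fin r) (k : Fin n) (l : Fin 1) :
    borderedMatrix n i j (Fin.castAdd 1 k) (Fin.natAdd n l) =
      -genericMatrix (n + r) (Fin.castAdd r k) (Fin.natAdd n j) := by
  simp [borderedMatrix]

theorem borderedMatrix_natAdd_castAdd (i j : Fin r) (k : Fin 1) (l : Fin n) :
    borderedMatrix n i j (Fin.natAdd n k) (Fin.castAdd 1 l) =
      -genericMatrix (n + r) (Fin.natAdd n i) (Fin.castAdd r l) := by
  simp [borderedMatrix]

theorem borderedMatrix_natAdd_natAdd (i j : Fin r) (k l : Fin 1) :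
    borderedMatrix n i j (Fin.natAdd n k) (Fin.natAdd n l) =
      -genericMatrix (n + r) (Fin.natAdd n i) (Fin.natAdd n j) := by
  simp [borderedMatrix]

theorem blockDeg_castAdd (i : Fin n) (j : Fin (n + r)) :
    blockDeg (Fin.castAdd r i, j) = (unitExp j, (0 : Fin r → ℤ)) - (unitExp (Fin.castAdd r i), 0) := by
  have h0 : (fun k : Fin r => unitExp (Fin.castAdd r i) (Fin.natAdd n k)) = 0 := by
    funext k
    have : Fin.natAdd n k ≠ Fin.castAdd r i := by
      simp only [ne_eq, Fin.ext_iff, Fin.val_castAdd, Fin.val_natAdd]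
      omega
    simp [unitExp, Pi.single_eq_of_ne this]
  rw [blockDeg]
  simp only [h0]
  simp

theorem blockDeg_natAdd (i : Fin r) (j : Fin (n + r)) :
    blockDeg (Fin.natAdd n i, j) =
      (unitExp j, (0 : Fin r → ℤ)) - (unitExp (Fin.natAdd n i), -unitExp i) := by
  have h0 : (fun k : Fin r => unitExp (Fin.natAdd n i) (Fin.natAdd n k)) = unitExp i := by
    funext k
    simp [unitExp, Pi.single_apply]
  rw [blockDeg]
  simp only [h0]
  simp

theorem colDet_block_mem : colDet (1 - (genericMatrix (n + r)).submatrix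
    (Fin.castAdd r) (Fin.castAdd r) : Matrix (Fin n) (Fin n) (NCPoly (n + r))) ∈
      homogeneousPart blockDeg 0 := by
  have := colDet_mem_homogeneousPart (deg := blockDeg) _ _ _ (one_submatrix_mem (n := n) (r := r))
  rwa [sub_self] at this

theorem colDet_bordered_mem (i j : Fin r) : colDet (borderedMatrix n i j) ∈
    homogeneousPart blockDeg (unitExp (Fin.natAdd n j) - unitExp (Fin.natAdd n i), unitExp i) := by
  have := colDet_mem_homogeneousPart (deg := blockDeg) (borderedMatrix n i j)
    (Fin.append (fun k => (unitExp (Fin.castAdd r k), 0))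
      fun _ : Fin 1 => (unitExp (Fin.natAdd n i), -unitExp i))
    (Fin.append (fun k => (unitExp (Fin.castAdd r k), 0))
      fun _ : Fin 1 => (unitExp (Fin.natAdd n j), 0)) ?_
  · convert this using 1
    rw [Fin.sum_univ_add, Fin.sum_univ_add]
    simp
  · intro k l
    refine Fin.addCases (fun k => ?_) (fun k => ?_) k <;>
      refine Fin.addCases (fun l => ?_) (fun l => ?_) l
    · rw [borderedMatrix_castAdd_castAdd, Fin.append_left, Fin.append_left]
      exact one_submatrix_mem k l
    · rw [borderedMatrix_castAdd_natAdd, Fin.append_left, Fin.append_right, ← blockDeg_castAdd]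
      exact Submodule.neg_mem _ (genericMatrix_mem_homogeneousPart _ _)
    · rw [borderedMatrix_natAdd_castAdd, Fin.append_left, Fin.append_right, ← blockDeg_natAdd]
      exact Submodule.neg_mem _ (genericMatrix_mem_homogeneousPart _ _)
    · rw [borderedMatrix_natAdd_natAdd, Fin.append_right, Fin.append_right, ← blockDeg_natAdd]
      exact Submodule.neg_mem _ (genericMatrix_mem_homogeneousPart _ _)

/-- Sylvester's identity over an algebra in which linear systems with matrices `1 - N` can be
solved, where the entries of `N` are scalar multiples of the entries of the upper left block. -/
theorem sylvesterIdentity_of_solvable (hq : ∀ i j, i < j → q i j ≠ 0)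
    (hind : ∀ (i : Fin n) (j j' : Fin r),
      q (Fin.castAdd r i) (Fin.natAdd n j) = q (Fin.castAdd r i) (Fin.natAdd n j'))
    {a : Matrix (Fin (n + r)) (Fin (n + r)) R} (ha : IsQCartierFoata q a)
    (hunit : IsUnit (qDetOneSubBlock q a))
    (hsolve : ∀ (s : Fin n → Fin n → ℂ) (v : Fin n → R), ∃ x : Fin n → R, ∀ i,
      x i - ∑ k, (s i k • a (Fin.castAdd r i) (Fin.castAdd r k)) * x k = v i) :
    SylvesterIdentity q a := by
  set A := twistedMatrix q a with hA
  have hcomm : ∀ i j, i ≠ j → ∀ p p', Commute (A i p) (A j p') :=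
    fun i j hij p p' => twistedMatrix_commute hq ha hij p p'
  have hone : ∀ {k : ℕ} (i j : Fin k) (y : Module.End ℂ (GradedFamily (Fin (n + r) → ℤ) R)),
      Commute ((1 : Matrix (Fin k) (Fin k) (Module.End ℂ (GradedFamily (Fin (n + r) → ℤ) R))) i j) y := by
    intro k i j y
    rw [Matrix.one_apply]
    split_ifs
    exacts [Commute.one_left _, Commute.zero_left _]
  have hone' := fun {k : ℕ} (i j : Fin k) (y : Module.End ℂ (GradedFamily (Fin (n + r) → ℤ) R)) =>
    (hone i j y).symm
  -- the solution of the linear system for the twisted block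
  choose x hx using fun (b : Fin (n + r) → ℤ) (j : Fin r) => hsolve
    (fun i k => letterScalar q (Fin.castAdd r i) (Fin.castAdd r k)
      (b + (unitExp (Fin.natAdd n j) - unitExp (Fin.castAdd r k))))
    (fun i => -(letterScalar q (Fin.castAdd r i) (Fin.natAdd n j) b •
      a (Fin.castAdd r i) (Fin.natAdd n j)))
  -- A homogeneous ansatz: with this shift the equation (1 - A₀) M = -A_{*j} splits into one linear
  -- system over R for every b and j, whose coefficients are entries of A₀ scaled by `letterScalar`.
  obtain ⟨M, hMdef⟩ : ∃ M : Matrix (Fin n) (Fin r) (Module.End ℂ (GradedFamily (Fin (n + r) → ℤ) R)),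
      ∀ k j, M k j = gradedOp (unitExp (Fin.natAdd n j) - unitExp (Fin.castAdd r k))
        fun b => x b j k := ⟨Matrix.of fun k j => _, fun _ _ => rfl⟩
  have hAM : ∀ (i : Fin (n + r)) (k : Fin n) (j : Fin r), A i (Fin.castAdd r k) * M k j =
      gradedOp (unitExp (Fin.natAdd n j) - unitExp i) fun b =>
        (letterScalar q i (Fin.castAdd r k)
          (b + (unitExp (Fin.natAdd n j) - unitExp (Fin.castAdd r k))) •
            a i (Fin.castAdd r k)) * x b j k := by
    intro i k j
    rw [hA, twistedMatrix, Matrix.of_apply, hMdef, gradedOp_mul]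
    congr 1
    abel
  have hM : ∀ (i : Fin n) (j : Fin r), ∑ k, ((1 : Matrix (Fin n) (Fin n)
      (Module.End ℂ (GradedFamily (Fin (n + r) → ℤ) R))) i k - A (Fin.castAdd r i) (Fin.castAdd r k)) *
        M k j = -A (Fin.castAdd r i) (Fin.natAdd n j) := by
    intro i j
    simp only [sub_mul, Finset.sum_sub_distrib, hAM]
    have h1 : ∑ k, (1 : Matrix (Fin n) (Fin n) (Module.End ℂ (GradedFamily (Fin (n + r) → ℤ) R))) i k *
        M k j = M i j := by
      rw [← Matrix.mul_apply, Matrix.one_mul]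
    rw [h1, hMdef, gradedOp_sum, gradedOp_sub, hA, twistedMatrix, Matrix.of_apply, gradedOp_neg]
    congr 1
    funext b
    have := hx b j i
    simpa using this
  -- the Schur complement of the twisted matrix
  obtain ⟨C, hCdef⟩ : ∃ C : Matrix (Fin r) (Fin r) (Module.End ℂ (GradedFamily (Fin (n + r) → ℤ) R)),
      ∀ i j, C i j = A (Fin.natAdd n i) (Fin.natAdd n j) -
        ∑ k, A (Fin.natAdd n i) (Fin.castAdd r k) * M k j :=
    ⟨Matrix.of fun i j => _, fun _ _ => rfl⟩
  have hC : ∀ i j, ∃ c : (Fin (n + r) → ℤ) → R,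
      C i j = gradedOp (unitExp (Fin.natAdd n j) - unitExp (Fin.natAdd n i)) c := by
    intro i j
    simp only [hCdef, hAM]
    rw [gradedOp_sum, hA, twistedMatrix, Matrix.of_apply, gradedOp_sub]
    exact ⟨_, rfl⟩
  choose c hc using hC
  set P : Module.End ℂ (GradedFamily (Fin (n + r) → ℤ) R) :=
    colDet (1 - A.submatrix (Fin.castAdd r) (Fin.castAdd r)) with hP
  have hPsub : substEntries A (colDet (1 - (genericMatrix (n + r)).submatrix
      (Fin.castAdd r) (Fin.castAdd r))) = P := by
    rw [map_colDet, hP]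
    congr 1
    ext1 i j
    rw [Matrix.map_apply, Matrix.sub_apply, Matrix.sub_apply, map_sub, Matrix.submatrix_apply,
      substEntries_genericMatrix, Matrix.one_apply, Matrix.one_apply, Matrix.submatrix_apply]
    split_ifs <;> simp
  -- the main determinant
  have hmain : colDet (1 - A) = P * colDet (1 - C) := by
    rw [colDet_schur (1 - A) ?_ M ?_]
    · congr 2
      · ext1 i j
        simp [Matrix.one_apply]
      · ext1 i j
        have h1 : ∀ k, (1 : Matrix (Fin (n + r)) (Fin (n + r))
            (Module.End ℂ (GradedFamily (Fin (n + r) → ℤ) R))) (Fin.natAdd n i) (Fin.castAdd r k) = 0 := by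
          intro k
          refine Matrix.one_apply_ne fun h => ?_
          simp only [Fin.ext_iff, Fin.val_castAdd, Fin.val_natAdd] at h
          omega
        rw [Matrix.of_apply, Matrix.sub_apply, Matrix.sub_apply, hCdef]
        simp only [Matrix.sub_apply, h1, zero_sub, neg_mul, Finset.sum_neg_distrib]
        simp [Matrix.one_apply]
        abel
    · intro i j hij p p'
      exact ((hone _ _ _).sub_right (hone _ _ _)).sub_left
        ((hone' _ _ _).sub_right (hcomm i j hij p p'))
    · intro i j
      have h1 : (1 : Matrix (Fin (n + r)) (Fin (n + r))
          (Module.End ℂ (GradedFamily (Fin (n + r) → ℤ) R))) (Fin.castAdd r i) (Fin.natAdd n j) = 0 := by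
        refine Matrix.one_apply_ne fun h => ?_
        simp only [Fin.ext_iff, Fin.val_castAdd, Fin.val_natAdd] at h
        omega
      rw [Matrix.sub_apply, h1, zero_sub, ← hM]
      simp [Matrix.one_apply]
  -- the bordered determinants
  have hbord : ∀ i j, substEntries A (colDet (borderedMatrix n i j)) = P * -C i j := by
    intro i j
    -- Column j of M also solves the system of the bordered matrix, whose Schur complement is the
    -- single entry -C i j.
    rw [map_colDet, colDet_schur (r := 1) _ ?_ (fun k _ => M k j) ?_]
    · rw [← hPsub, map_colDet]
      congr 2
      · ext1 k l
        rw [Matrix.submatrix_apply, Matrix.map_apply, borderedMatrix_castAdd_castAdd]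
        rfl
      · simp only [colDet, Matrix.map_apply, borderedMatrix_natAdd_natAdd,
          borderedMatrix_natAdd_castAdd, map_neg, substEntries_genericMatrix, Matrix.of_apply, hCdef]
        simp [sub_eq_add_neg, add_comm]
    · intro k l hkl p p'
      -- Each entry is a central element minus an entry of A, and distinct rows come from distinct
      -- rows of A.
      obtain ⟨k', hk', hrow⟩ : ∃ k' : Fin (n + 1) → Fin (n + r), Function.Injective k' ∧
          ∀ k p, ∃ (y : Module.End ℂ (GradedFamily (Fin (n + r) → ℤ) R)) (c : Fin (n + r)),
            (∀ z, Commute y z) ∧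
              (borderedMatrix n i j).map (substEntries A) k p = y - A (k' k) c := by
        refine ⟨Fin.append (Fin.castAdd r) fun _ => Fin.natAdd n i, ?_, ?_⟩
        · intro u v
          refine Fin.addCases (fun u => ?_) (fun u => ?_) u <;>
            refine Fin.addCases (fun v => ?_) (fun v => ?_) v <;>
            simp only [Fin.append_left, Fin.append_right, Fin.ext_iff, Fin.val_castAdd,
              Fin.val_natAdd] <;> omega
        · intro u p
          refine Fin.addCases (fun u => ?_) (fun u => ?_) u <;>
            refine Fin.addCases (fun p => ?_) (fun p => ?_) p <;>
            simp only [Fin.append_left, Fin.append_right, Matrix.map_apply,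
              borderedMatrix_castAdd_castAdd, borderedMatrix_castAdd_natAdd,
              borderedMatrix_natAdd_castAdd, borderedMatrix_natAdd_natAdd, Matrix.sub_apply,
              Matrix.submatrix_apply, map_sub, map_neg, substEntries_genericMatrix]
          · refine ⟨_, _, fun z => ?_, rfl⟩
            rw [Matrix.one_apply]
            split_ifs <;> simp
          all_goals exact ⟨0, _, fun z => Commute.zero_left z, (zero_sub _).symm⟩
      obtain ⟨y, e, hy, h1⟩ := hrow k p
      obtain ⟨y', e', hy', h2⟩ := hrow l p'
      rw [h1, h2]
      exact (hy _).sub_left ((hy' _).symm.sub_right (hcomm _ _ (hk'.ne hkl) _ _))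
    · intro k l
      rw [Matrix.map_apply, borderedMatrix_castAdd_natAdd, map_neg, substEntries_genericMatrix,
        ← hM]
      refine Finset.sum_congr rfl fun l' _ => ?_
      rw [Matrix.map_apply, borderedMatrix_castAdd_castAdd, Matrix.sub_apply, map_sub,
        Matrix.submatrix_apply, substEntries_genericMatrix, Matrix.one_apply, Matrix.one_apply]
      split_ifs <;> simp
  -- evaluation on concentrated families
  have hHuniv : ∀ i j, ∀ b ∈ (Set.univ : Set (Fin (n + r) → ℤ)),
      b + unitExp j - unitExp i ∈ (Set.univ : Set (Fin (n + r) → ℤ)) :=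
    fun _ _ _ _ => Set.mem_univ _
  have hTA : ∀ i j, ∀ b ∈ (Set.univ : Set (Fin (n + r) → ℤ)), ∀ y, A i j (placeAt R b y) =
      placeAt R (b + unitExp j - unitExp i) (letterScalar q i j b • (a i j * y)) :=
    fun i j b _ y => twistedMatrix_placeAt q a i j b y
  have hPval : ∀ (b : Fin r → ℤ), ∑ j, b j = 0 → ∀ y, P (placeAt R (Fin.append 0 b) y) =
      placeAt R (Fin.append 0 b) (qDetOneSubBlock q a * y) := by
    intro b hb y
    rw [← hPsub, substEntries_place_of_mem hq A a (placeAt R) Set.univ hHuniv hTA (Set.mem_univ _)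
      (wordScalar_of_blockDeg_eq_zero hind hq b hb) colDet_block_mem, one_smul]
    rfl
  have hshift : ∀ (b : Fin r → ℤ) (i j : Fin r), Fin.append 0 b + unitExp (Fin.natAdd n j) -
      unitExp (Fin.natAdd n i) = Fin.append 0 (b + unitExp j - unitExp i) := by
    intro b i j
    rw [append_zero_sub, append_zero_add, unitExp_natAdd, unitExp_natAdd]
  have hsum : ∀ (b : Fin r → ℤ) (i j : Fin r), ∑ k, b k = 0 →
      ∑ k, (b + unitExp j - unitExp i) k = 0 := by
    intro b i j hb
    simp [Finset.sum_add_distrib, Finset.sum_sub_distrib, hb]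
  have hCval : ∀ i j (b : Fin r → ℤ), ∑ k, b k = 0 → ∀ y, C i j (placeAt R (Fin.append 0 b) y) =
      placeAt R (Fin.append 0 (b + unitExp j - unitExp i))
        (letterScalar (fun i j => q (Fin.natAdd n i) (Fin.natAdd n j)) i j b •
          (schurMatrix q a i j * y)) := by
    intro i j b hb y
    have h1 : ∀ y, C i j (placeAt R (Fin.append 0 b) y) =
        placeAt R (Fin.append 0 (b + unitExp j - unitExp i)) (c i j (Fin.append 0 b) * y) := by
      intro y
      rw [hc, gradedOp_placeAt, ← add_sub_assoc, hshift]
    -- Reading the bordered identity in degree (0, b) gives `letterScalar` times the bordered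
    -- q-determinant as minus the block q-determinant times c i j; inverting the latter identifies c
    -- i j.
    have h2 := LinearMap.congr_fun (hbord i j) (placeAt R (Fin.append 0 b) 1)
    rw [substEntries_place_of_mem hq A a (placeAt R) Set.univ hHuniv hTA (Set.mem_univ _)
      (wordScalar_of_blockDeg_eq hind hq b hb i j) (colDet_bordered_mem i j), hshift, mul_neg,
      LinearMap.neg_apply, Module.End.mul_apply, h1, hPval _ (hsum b i j hb), ← map_neg] at h2
    have h3 := placeAt_injective _ h2
    rw [mul_one, mul_one, letterScalar_append] at h3
    rw [h1]
    congr 1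
    rw [← smul_mul_assoc]
    congr 1
    have h4 : c i j (Fin.append 0 b) =
        Ring.inverse (qDetOneSubBlock q a) * (qDetOneSubBlock q a * c i j (Fin.append 0 b)) := by
      rw [← mul_assoc, Ring.inverse_mul_cancel _ hunit, one_mul]
    rw [h4, ← neg_eq_iff_eq_neg.2 h3, schurMatrix, Matrix.of_apply]
    simp [qDet_eq]
  -- Starting in degree 0, every shift by C keeps the coordinate sum 0, so `hCval` applies
  -- throughout.
  have hfull := LinearMap.congr_fun hmain (placeAt R 0 1)
  rw [colDet_one_sub_placeAt hq A a (placeAt R) (fun i j b _ y => hTA i j b (Set.mem_univ _) y),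
    Module.End.mul_apply, ← append_zero_zero,
    colDet_one_sub_placeAt (fun i j h => hq _ _ ((Fin.natAdd_lt_natAdd_iff n).2 h)) C
      (schurMatrix q a) (fun b => placeAt R (Fin.append 0 b)) hCval, hPval _ (by simp)] at hfull
  have hfin := placeAt_injective _ hfull
  rw [mul_one, mul_one] at hfin
  rw [SylvesterIdentity, hfin, ← mul_assoc, Ring.inverse_mul_cancel _ hunit, one_mul]

end SylvesterOfSolvable

/-! ### Linear systems over non-commutative power series -/

namespace NCPowerSeries

variable {α : Type*}

/-- The constant coefficient. -/
def constCoeff : NCPowerSeries α →ₐ[ℂ] ℂ where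
  toFun f := f []
  map_one' := rfl
  map_mul' := mul_nil
  map_zero' := rfl
  map_add' _ _ := rfl
  commutes' c := by
    rw [Algebra.algebraMap_eq_smul_one, smul_apply, one_apply]
    simp

theorem sum_apply {κ : Type*} (s : Finset κ) (f : κ → NCPowerSeries α) (w : List α) :
    (∑ k ∈ s, f k) w = ∑ k ∈ s, f k w :=
  Finset.sum_apply w s f

/-- A product depends at the word `w` only on the coefficients of the right factor at words shorter
than `w` if the left factor has no constant term. -/
theorem mul_apply_congr {f g h : NCPowerSeries α} (hf : f [] = 0) (w : List α)
    (hgh : ∀ v : List α, v.length < w.length → g v = h v) : (f * g) w = (f * h) w := by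
  rw [mul_apply, mul_apply]
  refine Finset.sum_congr rfl fun p hp => ?_
  rw [Finset.mem_range] at hp
  rcases Nat.eq_zero_or_pos p with rfl | hp0
  · simp [hf]
  · rw [hgh]
    rw [List.length_drop]
    omega

/-- The system `x - N x = v` has a solution if the entries of `N` have no constant term. -/
theorem exists_sub_sum_mul_eq {κ : Type*} [Fintype κ] (N : κ → κ → NCPowerSeries α)
    (hN : ∀ i k, N i k [] = 0) (v : κ → NCPowerSeries α) :
    ∃ x : κ → NCPowerSeries α, ∀ i, x i - ∑ k, N i k * x k = v i := by
  -- the successive approximations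
  obtain ⟨y, hy0, hy⟩ : ∃ y : ℕ → κ → NCPowerSeries α, y 0 = v ∧
      ∀ d i, y (d + 1) i = v i + ∑ k, N i k * y d k :=
    ⟨fun d => Nat.rec v (fun _ y i => v i + ∑ k, N i k * y k) d, rfl, fun _ _ => rfl⟩
  -- Each iteration fixes the coefficients of one more length, since N raises word length by at
  -- least one.
  have hstep : ∀ d i (w : List α), w.length ≤ d → y (d + 1) i w = y d i w := by
    intro d
    induction d with
    | zero =>
      intro i w hw
      rw [List.length_eq_zero_iff.1 (Nat.le_zero.1 hw), hy, add_apply, sum_apply,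
        hy0, Finset.sum_eq_zero, add_zero]
      intro k _
      rw [mul_nil, hN, zero_mul]
    | succ d ih =>
      intro i w hw
      rw [hy (d + 1), hy d, add_apply, add_apply, sum_apply, sum_apply]
      congr 1
      exact Finset.sum_congr rfl fun k _ => mul_apply_congr (hN i k) w fun u hu => ih k u (by omega)
  have hstable : ∀ d i (w : List α), w.length ≤ d → y d i w = y w.length i w := by
    intro d i w hw
    induction d, hw using Nat.le_induction with
    | base => rfl
    | succ d hd ih => rw [hstep d i w hd, ih]
  obtain ⟨x, hx⟩ : ∃ x : κ → NCPowerSeries α, ∀ i w, x i w = y w.length i w :=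
    ⟨fun i w => y w.length i w, fun _ _ => rfl⟩
  refine ⟨x, fun i => ?_⟩
  rw [sub_eq_iff_eq_add]
  funext w
  rw [hx, ← hstep w.length i w le_rfl, hy, add_apply, add_apply, sum_apply, sum_apply]
  congr 1
  exact Finset.sum_congr rfl fun k _ => mul_apply_congr (hN i k) w
    fun u hu => (hstable _ k u hu.le).trans (hx k u).symm

theorem exists_mul_eq_one {f : NCPowerSeries α} (hf : f [] = 1) : ∃ g, f * g = 1 ∧ g [] = 1 := by
  obtain ⟨x, hx⟩ := exists_sub_sum_mul_eq (κ := Unit) (fun _ _ => 1 - f)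
    (fun _ _ => (constCoeff.map_sub 1 f).trans (by
      rw [map_one]
      exact sub_eq_zero.2 hf.symm)) (fun _ => 1)
  have h1 : f * x () = 1 := by
    have := hx ()
    simpa [sub_mul] using this
  refine ⟨x (), h1, ?_⟩
  have h2 := mul_nil f (x ())
  rw [h1, hf, one_mul] at h2
  exact h2.symm

theorem isUnit_of_constCoeff_eq_one {f : NCPowerSeries α} (hf : constCoeff f = 1) : IsUnit f := by
  obtain ⟨g, hfg, hg⟩ := exists_mul_eq_one hf
  obtain ⟨h, hgh, -⟩ := exists_mul_eq_one hg
  have hfh : f = h := by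
    rw [← mul_one f, ← hgh, ← mul_assoc, hfg, one_mul]
  exact ⟨⟨f, g, hfg, by rw [hfh, hgh]⟩, rfl⟩

theorem constCoeff_X (x : α) : constCoeff (X x) = 0 := by
  change (if [] = [x] then (1 : ℂ) else 0) = 0
  simp

end NCPowerSeries

/-! ### Passage to power series modulo an ideal -/

section Quotient

theorem map_substEntries {m : ℕ} {R S : Type*} [Ring R] [Algebra ℂ R] [Ring S] [Algebra ℂ S]
    (φ : R →ₐ[ℂ] S) (a : Matrix (Fin m) (Fin m) R) (f : NCPoly m) :
    φ (substEntries a f) = substEntries (a.map φ) f := by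
  induction f using MonoidAlgebra.induction_on with
  | of w =>
    rw [substEntries_of, substEntries_of, map_list_prod, List.map_map]
    rfl
  | add f g hf hg => rw [map_add, map_add, map_add, hf, hg]
  | smul c f hf => rw [map_smul, map_smul, map_smul, hf]

theorem colDet_eq_det {m : ℕ} {R : Type*} [CommRing R] (B : Matrix (Fin m) (Fin m) R) :
    colDet B = B.det := by
  simp only [colDet, Matrix.det_apply', List.prod_ofFn]

/-- Only the empty word survives the substitution of 0, and its weight is 1. -/
theorem substEntries_zero_applyWeight {m : ℕ} (q : Fin m → Fin m → ℂ) (f : NCPoly m) :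
    substEntries (0 : Matrix (Fin m) (Fin m) ℂ) (applyWeight q f) =
      substEntries (0 : Matrix (Fin m) (Fin m) ℂ) f := by
  induction f using MonoidAlgebra.induction_on with
  | of w =>
    rw [applyWeight_of, map_smul, substEntries_of]
    rcases hw : FreeMonoid.toList w with _ | ⟨p, u⟩
    · simp [wordWeight, inversionWeight_nil]
    · simp
  | add f g hf hg => rw [applyWeight_add, map_add, map_add, hf, hg]
  | smul c f hf => rw [applyWeight_smul, map_smul, map_smul, hf]

variable {m : ℕ} (J : TwoSidedIdeal (NCPowerSeries (Fin m × Fin m)))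

/-- The quotient map as an algebra homomorphism. -/
def quotSeriesHom : NCPowerSeries (Fin m × Fin m) →ₐ[ℂ] QuotSeries J :=
  { J.ringCon.mk' with commutes' := fun _ => rfl }

theorem quotSeriesHom_surjective : Function.Surjective (quotSeriesHom J) :=
  J.ringCon.mk'_surjective

theorem varMatrix_eq : varMatrix J =
    (Matrix.of fun i j => NCPowerSeries.X (i, j)).map (quotSeriesHom J) := rfl

variable {n r : ℕ} (J : TwoSidedIdeal (NCPowerSeries (Fin (n + r) × Fin (n + r))))

/-- The determinant lifts to a power series with constant term det 1 = 1, already invertible before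
passing to the quotient. -/
theorem isUnit_qDetOneSubBlock_varMatrix (q : Fin (n + r) → Fin (n + r) → ℂ) :
    IsUnit (qDetOneSubBlock q (varMatrix J)) := by
  rw [qDetOneSubBlock, varMatrix_eq, ← map_substEntries]
  refine IsUnit.map (quotSeriesHom J) (NCPowerSeries.isUnit_of_constCoeff_eq_one ?_)
  rw [map_substEntries]
  have h0 : (Matrix.of fun i j : Fin (n + r) => NCPowerSeries.X (i, j)).map
      (NCPowerSeries.constCoeff (α := Fin (n + r) × Fin (n + r))) = 0 := by
    ext i j
    exact NCPowerSeries.constCoeff_X (i, j)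
  rw [h0, qDet_eq, substEntries_zero_applyWeight, map_colDet]
  have h1 : (1 - (genericMatrix (n + r)).submatrix (Fin.castAdd r) (Fin.castAdd r) :
      Matrix (Fin n) (Fin n) (NCPoly (n + r))).map
        (substEntries (0 : Matrix (Fin (n + r)) (Fin (n + r)) ℂ)) = 1 := by
    ext1 i j
    rw [Matrix.map_apply, Matrix.sub_apply, map_sub, Matrix.submatrix_apply,
      substEntries_genericMatrix, Matrix.zero_apply, sub_zero, Matrix.one_apply, Matrix.one_apply]
    split_ifs <;> simp
  rw [h1, colDet_eq_det, Matrix.det_one]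

theorem sylvesterIdentity_varMatrix {q : Fin (n + r) → Fin (n + r) → ℂ}
    (hq : ∀ i j, i < j → q i j ≠ 0)
    (hind : ∀ (i : Fin n) (j j' : Fin r),
      q (Fin.castAdd r i) (Fin.natAdd n j) = q (Fin.castAdd r i) (Fin.natAdd n j'))
    (ha : IsQCartierFoata q (varMatrix J)) : SylvesterIdentity q (varMatrix J) := by
  refine sylvesterIdentity_of_solvable hq hind ha (isUnit_qDetOneSubBlock_varMatrix J q) ?_
  intro s v
  choose v' hv' using fun i => quotSeriesHom_surjective J (v i)
  obtain ⟨x, hx⟩ := NCPowerSeries.exists_sub_sum_mul_eq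
    (fun i k => s i k • NCPowerSeries.X (Fin.castAdd r i, Fin.castAdd r k)) (fun i k => by
      rw [NCPowerSeries.smul_apply]
      exact mul_eq_zero_of_right _ (NCPowerSeries.constCoeff_X (Fin.castAdd r i, Fin.castAdd r k))) v'
  refine ⟨fun i => quotSeriesHom J (x i), fun i => ?_⟩
  rw [← hv', ← hx, map_sub, map_sum]
  simp only [map_mul, map_smul]
  rfl

end Quotient

/-! ### The condition on the parameters cannot be dropped -/

namespace NCPowerSeries

variable {α : Type*}

theorem X_apply_nil (a : α) : X a [] = 0 := constCoeff_X a

theorem X_apply_cons [DecidableEq α] (a c : α) (w : List α) :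
    X a (c :: w) = if c = a ∧ w = [] then 1 else 0 := by
  simp [X]

theorem X_mul_apply_nil (a : α) (f : NCPowerSeries α) : (X a * f) [] = 0 := by
  rw [mul_nil, X_apply_nil, zero_mul]

theorem X_mul_apply_cons [DecidableEq α] (a c : α) (f : NCPowerSeries α) (w : List α) :
    (X a * f) (c :: w) = if c = a then f w else 0 := by
  rw [mul_cons, X_apply_nil, zero_mul, zero_add]
  split_ifs with hc
  · have : shift c (X a) = 1 := by
      funext v
      simp [shift, X, one_apply, hc]
    rw [this, one_mul]
  · have : shift c (X a) = 0 := by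
      funext v
      simp [shift, X, zero_apply, hc]
    rw [this, zero_mul, zero_apply]

/-- The ideal of the series that vanish in the algebra generated by letters `x, y, z` with
`y * x = u • x * y`, `z * x = v • x * z`, `z * y = t • y * z` and zero squares, in which all other
letters are zero. -/
def threeLetterIdeal (x y z : α) (u v t : ℂ) : TwoSidedIdeal (NCPowerSeries α) :=
  -- The conditions are the vanishing of the coefficients at 1, x, y, z, xy, xz, yz, xyz after
  -- sorting all words without repeated letters.
  TwoSidedIdeal.mk' {f | f [] = 0 ∧ f [x] = 0 ∧ f [y] = 0 ∧ f [z] = 0 ∧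
      f [x, y] + u * f [y, x] = 0 ∧ f [x, z] + v * f [z, x] = 0 ∧ f [y, z] + t * f [z, y] = 0 ∧
      f [x, y, z] + u * f [y, x, z] + t * f [x, z, y] + v * t * f [z, x, y] +
        u * v * f [y, z, x] + u * v * t * f [z, y, x] = 0}
    (by simp [zero_apply])
    (by
      rintro f g ⟨hf0, hf1, hf2, hf3, hf4, hf5, hf6, hf7⟩ ⟨hg0, hg1, hg2, hg3, hg4, hg5, hg6, hg7⟩
      simp only [Set.mem_ofPred_eq, add_apply, hf0, hf1, hf2, hf3, hg0, hg1, hg2, hg3, add_zero,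
        true_and]
      refine ⟨?_, ?_, ?_, ?_⟩
      · linear_combination hf4 + hg4
      · linear_combination hf5 + hg5
      · linear_combination hf6 + hg6
      · linear_combination hf7 + hg7)
    (by
      rintro f ⟨hf0, hf1, hf2, hf3, hf4, hf5, hf6, hf7⟩
      have hneg : ∀ w, (-f) w = -f w := fun _ => rfl
      simp only [Set.mem_ofPred_eq, hneg, hf0, hf1, hf2, hf3, neg_zero, true_and]
      refine ⟨?_, ?_, ?_, ?_⟩
      · linear_combination -hf4
      · linear_combination -hf5
      · linear_combination -hf6
      · linear_combination -hf7)
    (by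
      rintro f g ⟨hg0, hg1, hg2, hg3, hg4, hg5, hg6, hg7⟩
      simp only [Set.mem_ofPred_eq, mul_apply, List.length_cons, List.length_nil,
        Finset.sum_range_succ, Finset.sum_range_zero, List.take_zero, List.drop_zero,
        List.take_succ_cons, List.drop_succ_cons, zero_add, List.take_nil, List.drop_nil, hg0, hg1,
        hg2, hg3, mul_zero, add_zero, true_and]
      refine ⟨?_, ?_, ?_, ?_⟩
      · linear_combination f [] * hg4
      · linear_combination f [] * hg5
      · linear_combination f [] * hg6
      · linear_combination f [] * hg7 + f [x] * hg6 + u * f [y] * hg5 + v * t * f [z] * hg4)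
    (by
      rintro f g ⟨hg0, hg1, hg2, hg3, hg4, hg5, hg6, hg7⟩
      simp only [Set.mem_ofPred_eq, mul_apply, List.length_cons, List.length_nil,
        Finset.sum_range_succ, Finset.sum_range_zero, List.take_zero, List.drop_zero,
        List.take_succ_cons, List.drop_succ_cons, zero_add, List.take_nil, List.drop_nil, hg0, hg1,
        hg2, hg3, zero_mul, add_zero, true_and]
      refine ⟨?_, ?_, ?_, ?_⟩
      · linear_combination g [] * hg4
      · linear_combination g [] * hg5
      · linear_combination g [] * hg6
      · linear_combination g [] * hg7 + g [z] * hg4 + t * g [y] * hg5 + u * v * g [x] * hg6)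

theorem mem_threeLetterIdeal {x y z : α} {u v t : ℂ} {f : NCPowerSeries α} :
    f ∈ threeLetterIdeal x y z u v t ↔ f [] = 0 ∧ f [x] = 0 ∧ f [y] = 0 ∧ f [z] = 0 ∧
      f [x, y] + u * f [y, x] = 0 ∧ f [x, z] + v * f [z, x] = 0 ∧ f [y, z] + t * f [z, y] = 0 ∧
      f [x, y, z] + u * f [y, x, z] + t * f [x, z, y] + v * t * f [z, x, y] +
        u * v * f [y, z, x] + u * v * t * f [z, y, x] = 0 := by
  rw [threeLetterIdeal, TwoSidedIdeal.mem_mk']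
  rfl

end NCPowerSeries

/-! ### Explicit determinants for the counterexample -/

section LowRank

variable {E : Type*} [Ring E]

theorem colDet_fin_one (B : Matrix (Fin 1) (Fin 1) E) : colDet B = B 0 0 := by
  simp [colDet]

theorem colDet_fin_two (B : Matrix (Fin 2) (Fin 2) E) :
    colDet B = B 0 0 * B 1 1 - B 1 0 * B 0 1 := by
  have h : (Finset.univ : Finset (Equiv.Perm (Fin 2))) = {1, Equiv.swap 0 1} := by decide
  rw [colDet, h, Finset.sum_pair (by decide)]
  simp [sub_eq_add_neg]

theorem colDet_fin_three (B : Matrix (Fin 3) (Fin 3) E) :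
    colDet B = B 0 0 * (B 1 1 * B 2 2) - B 1 0 * (B 0 1 * B 2 2) - B 0 0 * (B 2 1 * B 1 2) -
      B 2 0 * (B 1 1 * B 0 2) + B 1 0 * (B 2 1 * B 0 2) + B 2 0 * (B 0 1 * B 1 2) := by
  have h : (Finset.univ : Finset (Equiv.Perm (Fin 3))) =
      {1, Equiv.swap 0 1, Equiv.swap 1 2, Equiv.swap 0 2, Equiv.swap 0 1 * Equiv.swap 1 2,
        Equiv.swap 1 2 * Equiv.swap 0 1} := by decide
  rw [colDet, h, Finset.sum_insert (by decide), Finset.sum_insert (by decide),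
    Finset.sum_insert (by decide), Finset.sum_insert (by decide), Finset.sum_pair (by decide)]
  have e1 : Equiv.swap (0 : Fin 3) 1 2 = 2 := by decide
  have e2 : Equiv.swap (1 : Fin 3) 2 0 = 0 := by decide
  have e3 : Equiv.swap (0 : Fin 3) 2 1 = 1 := by decide
  have s1 : Equiv.Perm.sign (Equiv.swap (0 : Fin 3) 1) = -1 := by decide
  have s2 : Equiv.Perm.sign (Equiv.swap (1 : Fin 3) 2) = -1 := by decide
  have s3 : Equiv.Perm.sign (Equiv.swap (0 : Fin 3) 2) = -1 := by decide
  simp [List.ofFn_succ, e1, e2, e3, s1, s2, s3]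
  abel

end LowRank

section ThreeLetterMatrix

variable {R : Type*} [Ring R] {x y z : R}

/-- The matrix with the only non-zero entries `x` at `(1, 0)`, `y` at `(2, 1)`, `z` at `(0, 2)`. -/
def threeLetterMatrix (x y z : R) : Matrix (Fin (1 + 2)) (Fin (1 + 2)) R :=
  !![0, 0, z; x, 0, 0; 0, y, 0]

theorem threeLetterMatrix_zero_zero : threeLetterMatrix x y z 0 0 = 0 := rfl
theorem threeLetterMatrix_zero_one : threeLetterMatrix x y z 0 1 = 0 := rfl
theorem threeLetterMatrix_zero_two : threeLetterMatrix x y z 0 2 = z := rfl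
theorem threeLetterMatrix_one_zero : threeLetterMatrix x y z 1 0 = x := rfl
theorem threeLetterMatrix_one_one : threeLetterMatrix x y z 1 1 = 0 := rfl
theorem threeLetterMatrix_one_two : threeLetterMatrix x y z 1 2 = 0 := rfl
theorem threeLetterMatrix_two_zero : threeLetterMatrix x y z 2 0 = 0 := rfl
theorem threeLetterMatrix_two_one : threeLetterMatrix x y z 2 1 = y := rfl
theorem threeLetterMatrix_two_two : threeLetterMatrix x y z 2 2 = 0 := rfl

end ThreeLetterMatrix

section ThreeLetters

open NCPowerSeries

variable {R : Type*} [Ring R] [Algebra ℂ R]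

/-- Substitution into a weighted polynomial. -/
def weightedSubst {m : ℕ} (q : Fin m → Fin m → ℂ) (a : Matrix (Fin m) (Fin m) R) :
    NCPoly m →ₗ[ℂ] R := (substEntries a).toLinearMap ∘ₗ applyWeightHom q

theorem weightedSubst_of {m : ℕ} (q : Fin m → Fin m → ℂ) (a : Matrix (Fin m) (Fin m) R)
    (w : List (Fin m × Fin m)) : weightedSubst q a (w.map fun p => genericMatrix m p.1 p.2).prod =
      wordWeight q w • (w.map fun p => a p.1 p.2).prod := by
  have h : (w.map fun p => genericMatrix m p.1 p.2).prod =
      MonoidAlgebra.of ℂ _ (FreeMonoid.ofList w) := by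
    induction w with
    | nil => exact (map_one (MonoidAlgebra.of ℂ _)).symm
    | cons p w ih =>
      rw [List.map_cons, List.prod_cons, ih, genericMatrix, Matrix.of_apply, ← map_mul]
      rfl
  rw [h]
  change substEntries a (applyWeight q _) = _
  rw [applyWeight_of, map_smul, substEntries_of]
  rfl

variable {m : ℕ} (q : Fin m → Fin m → ℂ) (a : Matrix (Fin m) (Fin m) R)

theorem weightedSubst_one : weightedSubst q a 1 = 1 := by
  simpa [wordWeight, inversionWeight_nil] using weightedSubst_of q a []

theorem weightedSubst_letter (i j : Fin m) :
    weightedSubst q a (genericMatrix m i j) = a i j := by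
  simpa [wordWeight, inversionWeight_nil, inversionWeight_cons_eq_prod] using
    weightedSubst_of q a [(i, j)]

theorem weightedSubst_mul (i j k l : Fin m) :
    weightedSubst q a (genericMatrix m i j * genericMatrix m k l) =
      (upperParam q l j * (upperParam q k i)⁻¹) • (a i j * a k l) := by
  simpa [wordWeight, inversionWeight_nil, inversionWeight_cons_eq_prod] using
    weightedSubst_of q a [(i, j), (k, l)]

theorem weightedSubst_mul_mul (i j k l s t : Fin m) :
    weightedSubst q a (genericMatrix m i j * (genericMatrix m k l * genericMatrix m s t)) =
      wordWeight q [(i, j), (k, l), (s, t)] • (a i j * (a k l * a s t)) := by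
  simpa using weightedSubst_of q a [(i, j), (k, l), (s, t)]

variable {q : Fin (1 + 2) → Fin (1 + 2) → ℂ} {x y z : R}

theorem isQCartierFoata_threeLetterMatrix (hyx : q 0 1 • (y * x) = q 1 2 • (x * y))
    (hxz : x * z = (q 0 1 * q 0 2) • (z * x)) (hyz : y * z = (q 0 2 * q 1 2) • (z * y)) :
    IsQCartierFoata q (threeLetterMatrix x y z) where
  rel_lt i j k l hij hkl := by
    fin_cases i <;> fin_cases j <;> fin_cases k <;> fin_cases l <;>
      first
      | exact absurd hij (by decide)
      | exact absurd hkl (by decide)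
      | exact hyx
      | simp [threeLetterMatrix]
  rel_gt i j k l hij hkl := by
    fin_cases i <;> fin_cases j <;> fin_cases k <;> fin_cases l <;>
      first
      | exact absurd hij (by decide)
      | exact absurd hkl (by decide)
      | exact hxz
      | exact hyz
      | simp [threeLetterMatrix]
  rel_eq i j k hij := by
    fin_cases i <;> fin_cases j <;> fin_cases k <;>
      first
      | exact absurd hij (by decide)
      | simp [threeLetterMatrix]

theorem qDetOneSubBlock_threeLetterMatrix :
    qDetOneSubBlock q (threeLetterMatrix x y z) = 1 := by
  change weightedSubst q _ (colDet _) = 1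
  rw [colDet_fin_one]
  change weightedSubst q (threeLetterMatrix x y z) (1 - genericMatrix (1 + 2) 0 0) = 1
  rw [map_sub, weightedSubst_one, weightedSubst_letter, threeLetterMatrix_zero_zero, sub_zero]

theorem schurMatrix_threeLetterMatrix :
    schurMatrix q (threeLetterMatrix x y z) = !![0, (q 0 1)⁻¹ • (x * z); y, 0] := by
  -- As the corner entry is 0, the block determinant is 1 and c_ij is a_ij plus a weighted product
  -- through index 0.
  have h : ∀ i j : Fin 2, schurMatrix q (threeLetterMatrix x y z) i j =
      threeLetterMatrix x y z (Fin.natAdd 1 i) (Fin.natAdd 1 j) +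
        (upperParam q (Fin.natAdd 1 j) 0 * (upperParam q 0 (Fin.natAdd 1 i))⁻¹) •
          (threeLetterMatrix x y z (Fin.natAdd 1 i) 0 *
            threeLetterMatrix x y z 0 (Fin.natAdd 1 j)) := by
    intro i j
    rw [schurMatrix, Matrix.of_apply, qDetOneSubBlock_threeLetterMatrix, Ring.inverse_one, one_mul]
    change -(weightedSubst q _ (colDet (m := 2) (borderedMatrix 1 i j))) = _
    rw [colDet_fin_two]
    have h00 : borderedMatrix 1 i j (0 : Fin 2) (0 : Fin 2) = 1 - genericMatrix (1 + 2) 0 0 :=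
      borderedMatrix_castAdd_castAdd i j 0 0
    have h01 : borderedMatrix 1 i j (0 : Fin 2) (1 : Fin 2) =
        -genericMatrix (1 + 2) 0 (Fin.natAdd 1 j) := borderedMatrix_castAdd_natAdd i j 0 0
    have h10 : borderedMatrix 1 i j (1 : Fin 2) (0 : Fin 2) =
        -genericMatrix (1 + 2) (Fin.natAdd 1 i) 0 := borderedMatrix_natAdd_castAdd i j 0 0
    have h11 : borderedMatrix 1 i j (1 : Fin 2) (1 : Fin 2) =
        -genericMatrix (1 + 2) (Fin.natAdd 1 i) (Fin.natAdd 1 j) :=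
      borderedMatrix_natAdd_natAdd i j 0 0
    rw [h00, h01, h10, h11, sub_mul, one_mul, neg_mul_neg, mul_neg, map_sub, map_sub, map_neg,
      map_neg, weightedSubst_mul, weightedSubst_mul, weightedSubst_letter,
      threeLetterMatrix_zero_zero, zero_mul, smul_zero]
    abel
  ext1 i j
  rw [h]
  have hp : ∀ j : Fin 2, upperParam q (Fin.natAdd 1 j) 0 = 1 := fun j => by
    simp [upperParam]
  fin_cases i <;> fin_cases j
  · change threeLetterMatrix x y z 1 1 + _ • (_ * threeLetterMatrix x y z 0 1) = 0
    simp [threeLetterMatrix_one_one, threeLetterMatrix_zero_one]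
  · change threeLetterMatrix x y z 1 2 + (_ * (upperParam q 0 1)⁻¹) • (x * z) = (q 0 1)⁻¹ • (x * z)
    rw [hp, threeLetterMatrix_one_two, zero_add, one_mul, upperParam, if_pos (by decide)]
  · change y + _ • (_ * threeLetterMatrix x y z 0 1) = y
    simp [threeLetterMatrix_zero_one]
  · change threeLetterMatrix x y z 2 2 + _ • (threeLetterMatrix x y z 2 0 * _) = 0
    simp [threeLetterMatrix_two_two, threeLetterMatrix_two_zero]

theorem qDetOneSub_threeLetterMatrix : qDetOneSub q (threeLetterMatrix x y z) =
    1 - (q 0 1 * q 0 2)⁻¹ • (x * (y * z)) := by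
  have hone : ∀ {i j : Fin 3}, i ≠ j → (1 : Matrix (Fin 3) (Fin 3) (NCPoly 3)) i j = 0 :=
    fun h => Matrix.one_apply_ne h
  change weightedSubst q _ (colDet (m := 3) (1 - genericMatrix 3)) = _
  rw [colDet_fin_three]
  simp only [Matrix.sub_apply, Matrix.one_apply_eq, hone (show (1 : Fin 3) ≠ 0 by decide),
    hone (show (0 : Fin 3) ≠ 1 by decide), hone (show (2 : Fin 3) ≠ 0 by decide),
    hone (show (0 : Fin 3) ≠ 2 by decide), hone (show (2 : Fin 3) ≠ 1 by decide),
    hone (show (1 : Fin 3) ≠ 2 by decide), zero_sub, sub_mul, mul_sub, one_mul, mul_one, neg_mul,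
    mul_neg, neg_neg, map_sub, map_add, map_neg]
  simp only [weightedSubst_one, weightedSubst_letter, weightedSubst_mul, weightedSubst_mul_mul,
    threeLetterMatrix_zero_zero, threeLetterMatrix_zero_one, threeLetterMatrix_zero_two,
    threeLetterMatrix_one_zero, threeLetterMatrix_one_one, threeLetterMatrix_one_two,
    threeLetterMatrix_two_zero, threeLetterMatrix_two_one, threeLetterMatrix_two_two, mul_zero,
    zero_mul, smul_zero, neg_zero, sub_zero, add_zero]
  -- Only the 3-cycle survives; the column word 0, 1, 2 has no inversions, and the row word 1, 2, 0
  -- has two.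
  have hw : wordWeight q [((1 : Fin 3), (0 : Fin 3)), (2, 1), (0, 2)] = (q 0 1 * q 0 2)⁻¹ := by
    have h4 : (0 : Fin 3) < 2 := by decide
    simp [wordWeight, inversionWeight_cons_eq_prod, inversionWeight_nil, upperParam, h4]
  rw [hw]
  abel

theorem sylvesterIdentity_threeLetterMatrix_iff :
    SylvesterIdentity q (threeLetterMatrix x y z) ↔
      (q 0 1 * q 0 2)⁻¹ • (x * (y * z)) = (q 1 2 * q 0 1)⁻¹ • (y * (x * z)) := by
  have h : qDetOneSub (fun i j : Fin 2 => q (Fin.natAdd 1 i) (Fin.natAdd 1 j))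
      (schurMatrix q (threeLetterMatrix x y z)) = 1 - (q 1 2 * q 0 1)⁻¹ • (y * (x * z)) := by
    rw [schurMatrix_threeLetterMatrix]
    change weightedSubst _ _ (colDet (1 - genericMatrix 2)) = _
    rw [colDet_fin_two]
    simp only [Matrix.sub_apply, Matrix.one_apply_eq,
      Matrix.one_apply_ne (show (1 : Fin 2) ≠ 0 by decide),
      Matrix.one_apply_ne (show (0 : Fin 2) ≠ 1 by decide), zero_sub, sub_mul, mul_sub, one_mul,
      mul_one, neg_mul_neg, map_sub, weightedSubst_one, weightedSubst_letter, weightedSubst_mul]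
    simp [upperParam, smul_smul, mul_comm (q 0 1)⁻¹]
  rw [SylvesterIdentity, qDetOneSubBlock_threeLetterMatrix, Ring.inverse_one, one_mul, h,
    qDetOneSub_threeLetterMatrix, sub_right_inj]

theorem exists_not_sylvesterIdentity (q : Fin (1 + 2) → Fin (1 + 2) → ℂ)
    (hq : ∀ i j, i < j → q i j ≠ 0) (hne : q 0 1 ≠ q 0 2) :
    ∃ J : TwoSidedIdeal (NCPowerSeries (Fin (1 + 2) × Fin (1 + 2))),
      IsQCartierFoata q (varMatrix J) ∧ ¬ SylvesterIdentity q (varMatrix J) := by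
  have h01 : q 0 1 ≠ 0 := hq 0 1 (by decide)
  have h02 : q 0 2 ≠ 0 := hq 0 2 (by decide)
  have h12 : q 1 2 ≠ 0 := hq 1 2 (by decide)
  -- The three constants are read off from the relations between a₂₁, a₃₂ and a₁₃, solved for yx, zx
  -- and zy.
  let J : TwoSidedIdeal (NCPowerSeries (Fin (1 + 2) × Fin (1 + 2))) :=
    threeLetterIdeal (1, 0) (2, 1) (0, 2) (q 1 2 / q 0 1) (q 0 1 * q 0 2)⁻¹ (q 0 2 * q 1 2)⁻¹
  have hmem : ∀ f g, quotSeriesHom J f = quotSeriesHom J g ↔ f - g ∈ J := fun f g =>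
    (RingCon.eq _).trans (TwoSidedIdeal.rel_iff J f g)
  have hsub : ∀ (f g : NCPowerSeries (Fin (1 + 2) × Fin (1 + 2))) w, (f - g) w = f w - g w :=
    fun _ _ _ => rfl
  have hA : varMatrix J = threeLetterMatrix (quotSeriesHom J (X (1, 0)))
      (quotSeriesHom J (X (2, 1))) (quotSeriesHom J (X (0, 2))) := by
    have hz : ∀ p : Fin (1 + 2) × Fin (1 + 2), p ≠ (1, 0) → p ≠ (2, 1) → p ≠ (0, 2) →
        quotSeriesHom J (X p) = 0 := by
      intro p h1 h2 h3
      rw [← map_zero (quotSeriesHom J), hmem, sub_zero, mem_threeLetterIdeal]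
      simp [X_apply_nil, X_apply_cons, h1.symm, h2.symm, h3.symm]
    ext1 i j
    rw [varMatrix_eq, Matrix.map_apply, Matrix.of_apply]
    fin_cases i <;> fin_cases j <;>
      first
      | rfl
      | exact hz _ (by decide) (by decide) (by decide)
  refine ⟨J, ?_, ?_⟩
  · rw [hA]
    refine isQCartierFoata_threeLetterMatrix ?_ ?_ ?_
    all_goals
      rw [← map_mul, ← map_mul, ← map_smul]
      try rw [← map_smul]
      rw [hmem, mem_threeLetterIdeal]
      simp [hsub, smul_apply, X_apply_nil, X_apply_cons, X_mul_apply_nil, X_mul_apply_cons]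
    all_goals field_simp
    all_goals ring
  · rw [hA, sylvesterIdentity_threeLetterMatrix_iff, ← map_mul, ← map_mul, ← map_mul, ← map_mul,
      ← map_smul, ← map_smul, hmem, mem_threeLetterIdeal]
    -- Only the coefficient of xyz matters; it forces q 0 1 = q 0 2.
    rintro ⟨-, -, -, -, -, -, -, h⟩
    simp [hsub, smul_apply, X_apply_cons, X_mul_apply_cons] at h
    field_simp at h
    exact hne (by linear_combination h)

end ThreeLetters

end

theorem mainTheorem5 :
    (∀ (n r : ℕ) (q : Fin (n + r) → Fin (n + r) → ℂ)
        (J : TwoSidedIdeal (NCPowerSeries (Fin (n + r) × Fin (n + r)))),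
      0 < r →
      (∀ i j, i < j → q i j ≠ 0) →
      (∀ (i i' : Fin n) (j j' : Fin r),
        q (Fin.castAdd r i) (Fin.natAdd n j) = q (Fin.castAdd r i') (Fin.natAdd n j')) →
      IsQCartierFoata q (varMatrix J) →
      IsUnit (qDetOneSubBlock q (varMatrix J)) ∧ SylvesterIdentity q (varMatrix J)) ∧
    (∀ q : Fin (1 + 2) → Fin (1 + 2) → ℂ,
      (∀ i j, i < j → q i j ≠ 0) →
      q 0 1 ≠ q 0 2 →
      ∃ J : TwoSidedIdeal (NCPowerSeries (Fin (1 + 2) × Fin (1 + 2))),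
        IsQCartierFoata q (varMatrix J) ∧
        IsUnit (qDetOneSubBlock q (varMatrix J)) ∧ ¬ SylvesterIdentity q (varMatrix J)) := by
  refine ⟨fun n r q J _ hq hq' hA => ⟨isUnit_qDetOneSubBlock_varMatrix J q,
    sylvesterIdentity_varMatrix J hq (fun i j j' => hq' i i j j') hA⟩, fun q hq hne => ?_⟩
  obtain ⟨J, hA, hJ⟩ := exists_not_sylvesterIdentity q hq hne
  exact ⟨J, hA, isUnit_qDetOneSubBlock_varMatrix J q, hJ⟩
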